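/- **Definitions.** A \emph{tournamenton} is a measurable function $W:[0,1]^2\to[0,\infty)$ with $W(x,y)+W(y,x)=1$ for all $(x,y)\in[0,1]^2$. For an oriented graph $H$ (no loops, at most one edge between any two vertices) with vertex set $V(H)$, edge set $E(H)$ and $\|H\|$ edges, let \[t(H,W)=\int_{[0,1]^{V(H)}}\prod_{vw\in E(H)}W(x_v,x_w)\,dx_{V(H)}.\] $H$ is \emph{quasirandom-forcing} if every tournamenton $W$ with $t(H,W)=2^{-\|H\|}$ is equal to $1/2$ almost everywhere. For $n\ge1$, let $Q_{2n}$ be the orientation of the path with $2n$ edges in which all edges are oriented from the central vertex towards the two end vertices. For $k\ge 2$, let $D_{2k}$ be the orientation of the cycle of length $2k$ obtained by choosing two opposite vertices and orienting all edges in the direction from one of them to the other. Let $C$ be an orientation of a cycle. For $F\subseteq E(C)$, let $C\langle F\rangle$ be the oriented graph with vertex set $V(C)$ and edge set $F$. For positive integers $n_1,\dots,n_k$, let $\alpha_C(2n_1,\dots,2n_k)$ be the number of sets $F\subseteq E(C)$ such that $C\langle F\rangle$ can be obtained (up to isomorphism) from the disjoint union $Q_{2n_1}\cup\dots\cup Q_{2n_k}$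 by reversing an even number of edges and possibly adding isolated vertices, minus the number of sets $F\subseteq E(C)$ such that $C\langle F\rangle$ can be so obtained by reversing an odd number of edges. If the length $\ell$ of $C$ is even, let $\gamma_C=1$ if $C$ can be obtained (up to isomorphism) from $D_\ell$ by reversing an even number of edges, and $\gamma_C=-1$ otherwise. **Theorem.** Let $C$ be an orientation of a cycle of even length $\ell$ (so $\ell\ge4$). (a) If $\gamma_C=1$ and \[\frac{\alpha_C(2)}{2^{\ell-2}}+\sum_{\substack{1\le n_1\le\cdots\le n_k\\ 3<k+2n_1+\cdots+2n_k\le\ell}}\frac{\min\{0,\alpha_C(2n_1,\ldots,2n_k)\}}{12^{k-1}\cdot\pi^{2n_1+\cdots+2n_k-2k}\cdot 2^{\ell-2n_1-\cdots-2n_k}}\ge 0,\] then $C$ is quasirandom-forcing. (b) If $\gamma_C=-1$ and \[\frac{\alpha_C(2)}{2^{\ell-2}}+\sum_{\substack{1\le n_1\le\cdots\le n_k\\ 3<k+2n_1+\cdots+2n_k\le\ell}}\frac{\max\{0,\alpha_C(2n_1,\ldots,2n_k)\}}{12^{k-1}\cdot\pi^{2n_1+\cdots+2n_k-2k}\cdot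 2^{\ell-2n_1-\cdots-2n_k}}\le 0,\] then $C$ is quasirandom-forcing. Both sums run over all $k\ge1$ and all integers $n_1,\dots,n_k$ satisfying the indicated constraints. -/

import Mathlib

open MeasureTheory unitInterval

/-- An oriented graph on the vertex set `V` with a finite edge set: `(u, v) ∈ edges` says that there
is an edge oriented from `u` to `v`. There are no loops, and every two vertices are joined by at most
one edge (take `u = v` in `asymm` for the absence of loops). -/
@[ext]
structure OrientedGraph (V : Type*) where
  edges : Finset (V × V)
  asymm : ∀ u v, (u, v) ∈ edges → (v, u) ∉ edges

namespace OrientedGraph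

/-- The underlying simple graph of an oriented graph. -/
def toSimpleGraph {V : Type*} (H : OrientedGraph V) : SimpleGraph V where
  Adj u v := (u, v) ∈ H.edges ∨ (v, u) ∈ H.edges
  symm := ⟨fun _ _ h => h.symm⟩
  loopless := ⟨fun u h => H.asymm u u (h.elim id id) (h.elim id id)⟩

/-- `H` is an orientation of a cycle of length `ℓ`. -/
def IsCycleOrientation {V : Type*} (H : OrientedGraph V) (ℓ : ℕ) : Prop :=
  3 ≤ ℓ ∧ Nonempty (H.toSimpleGraph ≃g SimpleGraph.cycleGraph ℓ)

/-- The spanning subgraph `H⟨F⟩`: same vertices, only the edges that lie in `F`. -/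
def restrict {V : Type*} [DecidableEq V] (H : OrientedGraph V) (F : Finset (V × V)) :
    OrientedGraph V where
  edges := H.edges ∩ F
  asymm u v h h' :=
    H.asymm u v (Finset.mem_inter.1 h).1 (Finset.mem_inter.1 h').1

/-- The oriented graph obtained from `H` by reversing exactly those edges that lie in `R`. -/
def reverse {V : Type*} [DecidableEq V] (H : OrientedGraph V) (R : Finset (V × V)) :
    OrientedGraph V where
  edges := (H.edges \ R) ∪ (H.edges ∩ R).image Prod.swap
  asymm u v h h' := by
    have key : ∀ a b : V, (a, b) ∈ (H.edges \ R) ∪ (H.edges ∩ R).image Prod.swap →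
        ((a, b) ∈ H.edges ∧ (a, b) ∉ R) ∨ ((b, a) ∈ H.edges ∧ (b, a) ∈ R) := by
      intro a b hab
      rcases Finset.mem_union.1 hab with hab | hab
      · exact Or.inl (Finset.mem_sdiff.1 hab)
      · obtain ⟨⟨c, d⟩, hcd, heq⟩ := Finset.mem_image.1 hab
        obtain ⟨rfl, rfl⟩ := Prod.mk.inj heq
        exact Or.inr (Finset.mem_inter.1 hcd)
    rcases key u v h with ⟨h1, h2⟩ | ⟨h1, h2⟩ <;> rcases key v u h' with ⟨h3, h4⟩ | ⟨h3, h4⟩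
    · exact H.asymm _ _ h1 h3
    · exact h2 h4
    · exact h4 h2
    · exact H.asymm _ _ h1 h3

/-- The disjoint union of a family of oriented graphs. -/
def disjointUnion {ι : Type*} [Fintype ι] {V : ι → Type*} (H : ∀ i, OrientedGraph (V i)) :
    OrientedGraph (Σ i, V i) where
  edges := (Finset.univ.sigma fun i => (H i).edges).map
    ⟨fun e => (⟨e.1, e.2.1⟩, ⟨e.1, e.2.2⟩), by
      rintro ⟨i, a, b⟩ ⟨j, c, d⟩ h
      simp only [Prod.mk.injEq, Sigma.mk.injEq] at h
      obtain ⟨⟨rfl, h1⟩, -, h2⟩ := h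
      cases h1; cases h2; rfl⟩
  asymm := by
    rintro ⟨i, a⟩ ⟨j, b⟩ h h'
    simp only [Finset.mem_map, Finset.mem_sigma, Finset.mem_univ, true_and] at h h'
    obtain ⟨⟨k, c, d⟩, h1, ⟨rfl, h2⟩, rfl, h3⟩ := h
    obtain ⟨⟨l, e, f⟩, h4, ⟨rfl, h5⟩, -, h6⟩ := h'
    exact (H _).asymm _ _ h1 h4

/-- `G` is (isomorphic to) the oriented graph `H` with possibly some isolated vertices added: the
vertices of `H` can be placed injectively among those of `G` so that the edges of `G` are exactly
the images of the edges of `H`. -/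
def IsCopyWithIsolated {W V : Type*} (H : OrientedGraph W) (G : OrientedGraph V) : Prop :=
  ∃ f : W ↪ V, G.edges = H.edges.map (f.prodMap f)

/-- `H` and `G` are isomorphic oriented graphs. -/
def IsIsomorphic {W V : Type*} (H : OrientedGraph W) (G : OrientedGraph V) : Prop :=
  ∃ f : W ≃ V, G.edges = H.edges.map (f.toEmbedding.prodMap f.toEmbedding)

/-- `Q n` is the oriented graph `Q_{2n}`: the path with `2n` edges on the vertices `0, 1, …, 2n`
(consecutive vertices being joined) with all edges oriented from the central vertex `n` towards the
two end vertices. -/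
def Q (n : ℕ) : OrientedGraph (Fin (2 * n + 1)) where
  edges := Finset.univ.filter fun e =>
    (n ≤ (e.1 : ℕ) ∧ (e.2 : ℕ) = e.1 + 1) ∨ ((e.1 : ℕ) ≤ n ∧ (e.1 : ℕ) = e.2 + 1)
  asymm u v h h' := by
    simp only [Finset.mem_filter, Finset.mem_univ, true_and] at h h'
    omega

/-- `D k` is the oriented graph `D_{2k}` (for `2 ≤ k`): the cycle on the vertices `0, 1, …, 2k - 1`
(in this cyclic order) with all edges oriented in the direction from the vertex `0` to the opposite
vertex `k`. -/
def D (k : ℕ) : OrientedGraph (Fin (2 * k)) where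
  edges := Finset.univ.filter fun e =>
    ((e.1 : ℕ) < k ∧ (e.2 : ℕ) = e.1 + 1) ∨ (k ≤ (e.2 : ℕ) ∧ (e.1 : ℕ) = e.2 + 1) ∨
      ((e.1 : ℕ) = 0 ∧ (e.2 : ℕ) = 2 * k - 1)
  asymm u v h h' := by
    simp only [Finset.mem_filter, Finset.mem_univ, true_and] at h h'
    have := u.isLt
    omega

/-- The disjoint union `Q_{2n_1} ∪ ⋯ ∪ Q_{2n_k}` for `ns = [n_1, …, n_k]`. -/
def QUnion (ns : List ℕ) : OrientedGraph (Σ i : Fin ns.length, Fin (2 * ns.get i + 1)) :=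
  disjointUnion fun i => Q (ns.get i)

open scoped Classical in
/-- The integer `α_C(2n_1, …, 2n_k)` for `ns = [n_1, …, n_k]`: the number of sets `F ⊆ E(C)` such
that `C⟨F⟩` can be obtained from `Q_{2n_1} ∪ ⋯ ∪ Q_{2n_k}` by reversing an even number of edges and
possibly adding isolated vertices, minus the number of those where an odd number is reversed. -/
noncomputable def alpha {V : Type*} (C : OrientedGraph V) (ns : List ℕ) : ℤ :=
  ((C.edges.powerset.filter fun F => ∃ R ⊆ (QUnion ns).edges,
      Even R.card ∧ ((QUnion ns).reverse R).IsCopyWithIsolated (C.restrict F)).card : ℤ) -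
  ((C.edges.powerset.filter fun F => ∃ R ⊆ (QUnion ns).edges,
      Odd R.card ∧ ((QUnion ns).reverse R).IsCopyWithIsolated (C.restrict F)).card : ℤ)

open scoped Classical in
/-- The sign `γ_C` of an orientation `C` of a cycle of even length `ℓ = |E(C)|`: it is `1` if `C` can
be obtained from `D_ℓ` by reversing an even number of edges, and `-1` otherwise. -/
noncomputable def gamma {V : Type*} (C : OrientedGraph V) : ℤ :=
  if ∃ R ⊆ (D (C.edges.card / 2)).edges,
      Even R.card ∧ ((D (C.edges.card / 2)).reverse R).IsIsomorphic C
  then 1 else -1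

/-- The homomorphism density `t(H, U)` of an oriented graph in a kernel on `[0,1]`. -/
noncomputable def homDensity {V : Type*} [Fintype V] (H : OrientedGraph V) (U : I → I → ℝ) : ℝ :=
  ∫ x : V → I, ∏ e ∈ H.edges, U (x e.1) (x e.2)

end OrientedGraph

/-- A tournamenton: a non-negative measurable function on `[0,1]²` with `W(x,y) + W(y,x) = 1`
everywhere (it is bounded, since these conditions force `0 ≤ W ≤ 1`). -/
structure IsTournamenton (W : I → I → ℝ) : Prop where
  measurable : Measurable fun z : I × I => W z.1 z.2
  nonneg : ∀ x y, 0 ≤ W x y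
  add_swap : ∀ x y, W x y + W y x = 1

/-- `H` is quasirandom-forcing: every tournamenton `W` with `t(H, W) = 2^{-‖H‖}` is equal to `1/2`
almost everywhere. -/
def OrientedGraph.QuasirandomForcing {V : Type*} [Fintype V] (H : OrientedGraph V) : Prop :=
  ∀ W : I → I → ℝ, IsTournamenton W → H.homDensity W = (1 / 2) ^ H.edges.card →
    ∀ᵐ z : I × I, W z.1 z.2 = 1 / 2

/-- The non-decreasing sequences `1 ≤ n_1 ≤ ⋯ ≤ n_k` of integers with
`3 < k + 2n_1 + ⋯ + 2n_k ≤ ℓ`. -/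
def patternSet (ℓ : ℕ) : Set (List ℕ) :=
  {ns | (∀ n ∈ ns, 1 ≤ n) ∧ ns.Pairwise (· ≤ ·) ∧
    3 < ns.length + 2 * ns.sum ∧ ns.length + 2 * ns.sum ≤ ℓ}

theorem patternSet_finite (ℓ : ℕ) : (patternSet ℓ).Finite := by
  have h : ((fun l : List (Fin (ℓ + 1)) => l.map Fin.val) ''
      {l : List (Fin (ℓ + 1)) | l.length ≤ ℓ}).Finite :=
    (List.finite_length_le (Fin (ℓ + 1)) ℓ).image _
  refine h.subset ?_
  rintro ns ⟨-, -, -, hle⟩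
  have hlt : ∀ n ∈ ns, n < ℓ + 1 := fun n hn => by
    have := List.le_sum_of_mem hn
    omega
  refine ⟨ns.attach.map fun n => ⟨n.1, hlt n.1 n.2⟩, ?_, ?_⟩
  · simp only [Set.mem_ofPred_eq, List.length_map, List.length_attach]
    omega
  · simp [List.map_map, Function.comp_def]

/-- The finite set of all `[n_1, …, n_k]` with `1 ≤ n_1 ≤ ⋯ ≤ n_k` and
`3 < k + 2n_1 + ⋯ + 2n_k ≤ ℓ`. -/
noncomputable def patterns (ℓ : ℕ) : Finset (List ℕ) := (patternSet_finite ℓ).toFinset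

/-!
Write a tournamenton as `W = 1/2 + U`. The kernel `U` is antisymmetric, so reversing an edge changes
the sign of a density in `U`. Expanding `t(C, W)` over the spanning subgraphs of `C`
(`homDensity_half_add`), the empty edge set contributes `2^{-ℓ}` and the full one
`γ_C t(D_ℓ, U)` (`homDensity_eq_gamma_mul`). A proper nonempty edge set is a disjoint union of
paths; its density vanishes if some path has odd length, because reversing that path changes the
sign, and otherwise it is `±∏ t(Q_{2n_i}, U)`. Collecting terms, the coefficients are the numbers
`α_C` (`homDensity_cycle_expansion`); here `QUnion_unique` ensures that each edge set is counted for
only one list `n_1 ≤ ⋯ ≤ n_k`.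

Let `T` be the integral operator with kernel `U`. Integrating over walks gives
`t(Q_{2n}, U) = ‖T^n 1‖²` and `t(D_{2k}, U) = ∫ ‖T^{k-1} U(·, y)‖² dy`. Hence all these densities are
non-negative, and the statement follows from three facts.

* `t(Q_2, U) ≤ 1/12` (`integral_sq_kerOp_one_le`): symmetrise the integrand over three variables.
* `‖T‖ ≤ 1/π` (`integral_sq_kerOp_le`), so `t(Q_{2n}, U) ≤ π^{-2(n-1)} t(Q_2, U)`. By antisymmetry,
  `2⟨f, T g⟩` is at most half of the integral of `|f(x) g(y) - f(y) g(x)|`, and that integral is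
  bounded by the isoperimetric inequality for zonoids (`integral_abs_cross_le`), which follows from
  the Fourier series of `|sin|`.
* If `t(D_{2k}, U) = 0`, then `U = 0` almost everywhere (`ae_eq_zero_of_homDensity_D`): `T` is
  normal, so `T` itself vanishes, and a kernel is determined by its integrals over rectangles.

The first two facts bound the terms with an unfavourable sign by `t(Q_2, U)` times the weights in
the hypothesis (`criterion_le`). So `t(C, W) = 2^{-ℓ}` forces `t(D_ℓ, U) = 0`.
-/

/-! ### The Fourier expansion of `|sin|` -/

theorem integral_exp_mul_sin (n : ℤ) :
    ∫ x in (0 : ℝ)..Real.pi, Complex.exp (-2 * n * Complex.I * x) * (Real.sin x : ℂ) =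
      2 / (1 - 4 * (n : ℂ) ^ 2) := by
  have hne : (1 - 4 * (n : ℂ) ^ 2) ≠ 0 := by
    have h : (1 - 4 * n ^ 2 : ℤ) ≠ 0 := by omega
    exact_mod_cast h
  set c : ℂ := -2 * n * Complex.I with hc
  have hc2 : c ^ 2 + 1 = 1 - 4 * (n : ℂ) ^ 2 := by
    rw [hc]; ring_nf; rw [Complex.I_sq]; ring
  -- The antiderivative of `exp (c x) sin x`.
  have hderiv : ∀ x ∈ Set.uIcc (0 : ℝ) Real.pi, HasDerivAt
      (fun x : ℝ => Complex.exp (c * x) * (c * Complex.sin x - Complex.cos x) / (c ^ 2 + 1))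
      (Complex.exp (c * x) * (Real.sin x : ℂ)) x := by
    intro x _
    have h1 : HasDerivAt (fun z : ℂ => Complex.exp (c * z) *
        (c * Complex.sin z - Complex.cos z) / (c ^ 2 + 1))
        (Complex.exp (c * x) * Complex.sin x) x := by
      have he : HasDerivAt (fun z : ℂ => Complex.exp (c * z)) (Complex.exp (c * x) * (c * 1)) x :=
        ((hasDerivAt_id (x : ℂ)).const_mul c).cexp
      have hs := ((Complex.hasDerivAt_sin x).const_mul c).sub (Complex.hasDerivAt_cos x)
      convert! (he.mul hs).div_const (c ^ 2 + 1) using 1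
      rw [hc2]
      field_simp
      rw [← hc2]
      simp only [Pi.sub_apply]
      ring
    rw [Complex.ofReal_sin]
    exact h1.comp_ofReal
  rw [intervalIntegral.integral_eq_sub_of_hasDerivAt hderiv
    ((by fun_prop : Continuous _).intervalIntegrable _ _)]
  have hexp : Complex.exp (c * (Real.pi : ℂ)) = 1 := by
    rw [Complex.exp_eq_one_iff]
    exact ⟨-n, by rw [hc]; push_cast; ring⟩
  rw [hexp, hc2]
  simp
  ring

/-- The Fourier expansion of `|sin|`. Only its constant term has a positive coefficient. -/
theorem hasSum_abs_sin (t : ℝ) :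
    HasSum (fun n : ℤ => 2 / (Real.pi * (1 - 4 * (n : ℝ) ^ 2)) * Real.cos (2 * n * t))
      |Real.sin t| := by
  have : Fact (0 < Real.pi) := ⟨Real.pi_pos⟩
  have hper : Function.Periodic (fun x : ℝ => ((|Real.sin x| : ℝ) : ℂ)) Real.pi := by
    intro x
    simp [Real.sin_add_pi]
  let f : C(AddCircle Real.pi, ℂ) :=
    ⟨hper.lift, continuous_coinduced_dom.2 (by
      change Continuous fun x : ℝ => ((|Real.sin x| : ℝ) : ℂ)
      fun_prop)⟩
  have hf : ∀ x : ℝ, f (x : AddCircle Real.pi) = ((|Real.sin x| : ℝ) : ℂ) := fun x => rfl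
  have hcoeff : ∀ n : ℤ, fourierCoeff f n = ((2 / (Real.pi * (1 - 4 * (n : ℝ) ^ 2)) : ℝ) : ℂ) := by
    intro n
    rw [fourierCoeff_eq_intervalIntegral _ _ 0, zero_add]
    have : ∫ x in (0 : ℝ)..Real.pi, fourier (-n) (x : AddCircle Real.pi) • f x =
        ∫ x in (0 : ℝ)..Real.pi, Complex.exp (-2 * n * Complex.I * x) * (Real.sin x : ℂ) := by
      refine intervalIntegral.integral_congr fun x hx => ?_
      rw [Set.uIcc_of_le Real.pi_pos.le] at hx
      simp only [hf, fourier_coe_apply, smul_eq_mul,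
        abs_of_nonneg (Real.sin_nonneg_of_mem_Icc hx)]
      congr 2
      have : (Real.pi : ℂ) ≠ 0 := by exact_mod_cast Real.pi_ne_zero
      push_cast
      field_simp
    rw [this, integral_exp_mul_sin]
    push_cast
    rw [Complex.real_smul]
    push_cast
    rw [div_mul_div_comm, one_mul]
  have hsumm : Summable (fourierCoeff f) := by
    have h2 : Summable fun n : ℤ => (2 / Real.pi) * (1 / (n : ℝ) ^ 2) :=
      (Real.summable_one_div_int_pow.2 (by norm_num)).mul_left _
    refine Summable.of_norm_bounded_eventually h2 ?_
    refine (Set.finite_singleton (0 : ℤ)).subset fun n hn => ?_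
    by_contra h0
    apply hn
    have h0' : n ≠ 0 := h0
    have h1 : (1 : ℝ) ≤ (n : ℝ) ^ 2 := by
      have : (1 : ℤ) ≤ n ^ 2 := by
        have := sq_nonneg n
        have : n ^ 2 ≠ 0 := pow_ne_zero 2 h0'
        omega
      exact_mod_cast this
    change ‖fourierCoeff f n‖ ≤ _
    rw [hcoeff, Complex.norm_real, Real.norm_eq_abs, abs_div, abs_mul, abs_of_pos Real.pi_pos,
      abs_of_neg (by linarith : (1 - 4 * (n : ℝ) ^ 2) < 0), abs_two, div_mul_div_comm, mul_one]
    have := Real.pi_pos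
    gcongr
    linarith
  have h := has_pointwise_sum_fourier_series_of_summable hsumm (t : AddCircle Real.pi)
  have h' := Complex.hasSum_re h
  rw [hf, Complex.ofReal_re] at h'
  convert! h' using 2 with n
  rw [hcoeff, smul_eq_mul, Complex.re_ofReal_mul, fourier_coe_apply]
  congr 1
  have : (2 * Real.pi * Complex.I * n * t / Real.pi : ℂ) = ((2 * n * t : ℝ) : ℂ) * Complex.I := by
    have : (Real.pi : ℂ) ≠ 0 := by exact_mod_cast Real.pi_ne_zero
    push_cast
    field_simp
  rw [this, Complex.exp_ofReal_mul_I_re]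

/-! ### Bounded measurable functions and antisymmetric kernels -/

/-- A bounded measurable real function. -/
structure BddMeas {α : Type*} [MeasurableSpace α] (f : α → ℝ) : Prop where
  measurable : Measurable f
  bdd : ∃ B, ∀ x, |f x| ≤ B

namespace BddMeas

variable {α β : Type*} [MeasurableSpace α] [MeasurableSpace β] {f g : α → ℝ}

theorem integrable (hf : BddMeas f) (μ : Measure α) [IsFiniteMeasure μ] : Integrable f μ := by
  obtain ⟨B, hB⟩ := hf.bdd
  exact Integrable.of_bound hf.measurable.aestronglyMeasurable B (ae_of_all _ hB)

theorem const (c : ℝ) : BddMeas fun _ : α => c := ⟨measurable_const, |c|, fun _ => le_rfl⟩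

theorem neg (hf : BddMeas f) : BddMeas fun x => -f x := by
  obtain ⟨B, hB⟩ := hf.bdd
  exact ⟨hf.measurable.neg, B, fun x => by rw [abs_neg]; exact hB x⟩

theorem mul (hf : BddMeas f) (hg : BddMeas g) : BddMeas fun x => f x * g x := by
  obtain ⟨B, hB⟩ := hf.bdd
  obtain ⟨B', hB'⟩ := hg.bdd
  refine ⟨hf.measurable.mul hg.measurable, B * B', fun x => ?_⟩
  rw [abs_mul]
  exact mul_le_mul (hB x) (hB' x) (abs_nonneg _) ((abs_nonneg _).trans (hB x))

theorem add (hf : BddMeas f) (hg : BddMeas g) : BddMeas fun x => f x + g x := by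
  obtain ⟨B, hB⟩ := hf.bdd
  obtain ⟨B', hB'⟩ := hg.bdd
  exact ⟨hf.measurable.add hg.measurable, B + B',
    fun x => (abs_add_le _ _).trans (add_le_add (hB x) (hB' x))⟩

theorem sub (hf : BddMeas f) (hg : BddMeas g) : BddMeas fun x => f x - g x := by
  simpa only [sub_eq_add_neg] using hf.add hg.neg

theorem abs (hf : BddMeas f) : BddMeas fun x => |f x| := by
  obtain ⟨B, hB⟩ := hf.bdd
  exact ⟨hf.measurable.abs, B, fun x => by rw [abs_abs]; exact hB x⟩

theorem pow (hf : BddMeas f) (n : ℕ) : BddMeas fun x => f x ^ n := by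
  obtain ⟨B, hB⟩ := hf.bdd
  refine ⟨hf.measurable.pow_const n, B ^ n, fun x => ?_⟩
  rw [abs_pow]
  exact pow_le_pow_left₀ (abs_nonneg _) (hB x) n

theorem prod {ι : Type*} (s : Finset ι) {F : ι → α → ℝ} (h : ∀ i ∈ s, BddMeas (F i)) :
    BddMeas fun x => ∏ i ∈ s, F i x := by
  classical
  induction s using Finset.induction_on with
  | empty => simpa using const 1
  | insert i s hi ih =>
    simp only [Finset.prod_insert hi]
    exact (h i (Finset.mem_insert_self _ _)).mul
      (ih fun j hj => h j (Finset.mem_insert_of_mem hj))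

theorem comp (hf : BddMeas f) {φ : β → α} (hφ : Measurable φ) : BddMeas fun x => f (φ x) := by
  obtain ⟨B, hB⟩ := hf.bdd
  exact ⟨hf.measurable.comp hφ, B, fun x => hB _⟩

theorem integral_right {F : α × β → ℝ} (hF : BddMeas F) (μ : Measure β) [IsProbabilityMeasure μ] :
    BddMeas fun x => ∫ y, F (x, y) ∂μ := by
  obtain ⟨B, hB⟩ := hF.bdd
  refine ⟨hF.measurable.stronglyMeasurable.integral_prod_right'.measurable, B, fun x => ?_⟩
  have := norm_integral_le_of_norm_le_const (μ := μ) (f := fun y => F (x, y)) (C := B)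
    (ae_of_all _ fun y => hB (x, y))
  simpa using this

theorem integral_add (hf : BddMeas f) (hg : BddMeas g) (μ : Measure α) [IsFiniteMeasure μ] :
    ∫ x, (f x + g x) ∂μ = ∫ x, f x ∂μ + ∫ x, g x ∂μ :=
  MeasureTheory.integral_add (hf.integrable μ) (hg.integrable μ)

theorem integral_sub (hf : BddMeas f) (hg : BddMeas g) (μ : Measure α) [IsFiniteMeasure μ] :
    ∫ x, (f x - g x) ∂μ = ∫ x, f x ∂μ - ∫ x, g x ∂μ :=
  MeasureTheory.integral_sub (hf.integrable μ) (hg.integrable μ)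

theorem integral_mono (hf : BddMeas f) (hg : BddMeas g) (μ : Measure α) [IsFiniteMeasure μ]
    (h : ∀ x, f x ≤ g x) : ∫ x, f x ∂μ ≤ ∫ x, g x ∂μ :=
  MeasureTheory.integral_mono (hf.integrable μ) (hg.integrable μ) h

theorem integral_le (hf : BddMeas f) (μ : Measure α) [IsProbabilityMeasure μ] {c : ℝ}
    (h : ∀ x, f x ≤ c) : ∫ x, f x ∂μ ≤ c := by
  simpa using hf.integral_mono (const c) μ h

end BddMeas

/-- A measurable kernel on `[0,1]²` that is antisymmetric and bounded by `1/2`: the deviation of a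
tournamenton from the constant `1/2`. -/
structure IsAntisymmKernel (U : I → I → ℝ) : Prop where
  measurable : Measurable fun z : I × I => U z.1 z.2
  antisymm : ∀ x y, U y x = -U x y
  abs_le : ∀ x y, |U x y| ≤ 1 / 2

/-- The integral operator with kernel `U`. -/
noncomputable def kerOp (U : I → I → ℝ) (f : I → ℝ) (x : I) : ℝ := ∫ y, U x y * f y

theorem kerOp_one (U : I → I → ℝ) (x : I) : kerOp U (fun _ => 1) x = ∫ y, U x y := by
  simp [kerOp]

namespace IsAntisymmKernel

variable {U : I → I → ℝ} (hU : IsAntisymmKernel U)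
include hU

theorem bddMeas : BddMeas fun z : I × I => U z.1 z.2 :=
  ⟨hU.measurable, 1 / 2, fun z => hU.abs_le z.1 z.2⟩

theorem bddMeas_comp {α : Type*} [MeasurableSpace α] {a b : α → I} (ha : Measurable a)
    (hb : Measurable b) : BddMeas fun x => U (a x) (b x) :=
  hU.bddMeas.comp (ha.prodMk hb)

/-- Applying the operator to a measurable family of functions gives a measurable family. -/
theorem bddMeas_kerOp_family {α : Type*} [MeasurableSpace α] {h : α → I → ℝ}
    (hh : BddMeas fun p : α × I => h p.1 p.2) :
    BddMeas fun p : α × I => kerOp U (h p.1) p.2 := by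
  unfold kerOp
  exact BddMeas.integral_right (F := fun q : (α × I) × I => U q.1.2 q.2 * h q.1.1 q.2)
    ((hU.bddMeas_comp (by fun_prop) (by fun_prop)).mul
      (hh.comp (φ := fun q : (α × I) × I => (q.1.1, q.2)) (by fun_prop))) _

theorem bddMeas_kerOp_iterate_family {α : Type*} [MeasurableSpace α] {h : α → I → ℝ}
    (hh : BddMeas fun p : α × I => h p.1 p.2) (n : ℕ) :
    BddMeas fun p : α × I => (kerOp U)^[n] (h p.1) p.2 := by
  induction n with
  | zero => exact hh
  | succ n ih =>
    simp only [Function.iterate_succ_apply']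
    exact hU.bddMeas_kerOp_family (h := fun a => (kerOp U)^[n] (h a)) ih

theorem bddMeas_kerOp {f : I → ℝ} (hf : BddMeas f) : BddMeas (kerOp U f) :=
  (hU.bddMeas_kerOp_family (α := Unit) (h := fun _ => f) (hf.comp measurable_snd)).comp
    (φ := fun x => ((), x)) (by fun_prop)

theorem bddMeas_kerOp_iterate {f : I → ℝ} (hf : BddMeas f) (n : ℕ) :
    BddMeas ((kerOp U)^[n] f) := by
  induction n with
  | zero => exact hf
  | succ n ih =>
    rw [Function.iterate_succ_apply']
    exact hU.bddMeas_kerOp ih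

theorem integral_mul_kerOp {f g : I → ℝ} (hf : BddMeas f) (hg : BddMeas g) :
    ∫ x, f x * kerOp U g x = -∫ x, kerOp U f x * g x := by
  have hint : BddMeas fun z : I × I => f z.1 * (U z.1 z.2 * g z.2) :=
    (hf.comp measurable_fst).mul (hU.bddMeas.mul (hg.comp measurable_snd))
  calc ∫ x, f x * kerOp U g x = ∫ x, ∫ y, f x * (U x y * g y) := by
        simp only [kerOp, integral_const_mul]
    _ = ∫ y, ∫ x, f x * (U x y * g y) :=
        integral_integral_swap (f := fun x y => f x * (U x y * g y)) (hint.integrable _)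
    _ = ∫ y, -(kerOp U f y * g y) := by
        refine integral_congr_ae (ae_of_all _ fun y => ?_)
        simp only [kerOp]
        rw [← integral_mul_const, ← integral_neg]
        refine integral_congr_ae (ae_of_all _ fun x => ?_)
        simp only
        rw [hU.antisymm x y]
        ring
    _ = -∫ x, kerOp U f x * g x := integral_neg _

theorem integral_mul_kerOp_iterate {f g : I → ℝ} (hf : BddMeas f) (hg : BddMeas g) (n : ℕ) :
    ∫ x, f x * (kerOp U)^[n] g x = (-1) ^ n * ∫ x, (kerOp U)^[n] f x * g x := by
  induction n generalizing f with
  | zero => simp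
  | succ n ih =>
    rw [Function.iterate_succ_apply', hU.integral_mul_kerOp hf (hU.bddMeas_kerOp_iterate hg n),
      ih (hU.bddMeas_kerOp hf), Function.iterate_succ_apply, pow_succ]
    ring

/-- Symmetrising in three variables reduces this to the inequality
`U x y * U x z - U x y * U y z + U y z * U x z ≤ 1/4`, which is multilinear in numbers from
`[-1/2, 1/2]`. -/
theorem integral_sq_kerOp_one_le : ∫ x, kerOp U (fun _ => 1) x ^ 2 ≤ 1 / 12 := by
  set d : I → ℝ := kerOp U (fun _ => 1) with hd
  have hone : BddMeas fun _ : I => (1 : ℝ) := BddMeas.const 1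
  have hdm : BddMeas d := hU.bddMeas_kerOp hone
  have hrow : ∀ x, BddMeas (U x) := fun x => hU.bddMeas_comp measurable_const measurable_id
  have hpt : ∀ x y z, U x y * U x z - U x y * U y z + U y z * U x z ≤ 1 / 4 := by
    intro x y z
    obtain ⟨a1, a2⟩ := _root_.abs_le.1 (hU.abs_le x y)
    obtain ⟨p1, p2⟩ := _root_.abs_le.1 (hU.abs_le x z)
    obtain ⟨q1, q2⟩ := _root_.abs_le.1 (hU.abs_le y z)
    rcases le_total (U y z) (U x z) with h | h
    · nlinarith [mul_nonneg (sub_nonneg.2 a2) (sub_nonneg.2 h),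
        mul_nonneg (sub_nonneg.2 p2) (by linarith : 0 ≤ 1 / 2 + U y z)]
    · nlinarith [mul_nonneg (by linarith : 0 ≤ 1 / 2 + U x y) (sub_nonneg.2 h),
        mul_nonneg (sub_nonneg.2 q2) (by linarith : 0 ≤ 1 / 2 + U x z)]
  -- Integrate the pointwise inequality over `z`, then over `y`, then over `x`.
  have h1 : ∀ x y, U x y * d x - U x y * d y + kerOp U (U x) y ≤ 1 / 4 := by
    intro x y
    have i1 := (hrow x).mul (BddMeas.const (U x y))
    have i2 := (hrow y).mul (BddMeas.const (U x y))
    have i3 := (hrow y).mul (hrow x)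
    have : U x y * d x - U x y * d y + kerOp U (U x) y =
        ∫ z, (U x z * U x y - U y z * U x y + U y z * U x z) := by
      rw [(i1.sub i2).integral_add i3, i1.integral_sub i2, integral_mul_const, integral_mul_const,
        hd, kerOp_one, kerOp_one, kerOp]
      ring
    rw [this]
    exact ((i1.sub i2).add i3).integral_le _ fun z => by linarith [hpt x y z]
  have h2 : ∀ x, d x ^ 2 - 2 * kerOp U d x ≤ 1 / 4 := by
    intro x
    have i1 := (hrow x).mul (BddMeas.const (d x))
    have i2 := (hrow x).mul hdm
    have i3 := hU.bddMeas_kerOp (hrow x)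
    have h3 : ∫ y, kerOp U (U x) y = -kerOp U d x := by
      have := hU.integral_mul_kerOp hone (hrow x)
      simp only [one_mul] at this
      rw [this, kerOp]
      simp only [← hd, mul_comm]
    have : d x ^ 2 - 2 * kerOp U d x =
        ∫ y, (U x y * d x - U x y * d y + kerOp U (U x) y) := by
      rw [(i1.sub i2).integral_add i3, i1.integral_sub i2, integral_mul_const, h3,
        ← kerOp_one, ← hd]
      simp only [kerOp]
      ring
    rw [this]
    exact ((i1.sub i2).add i3).integral_le _ (h1 x)
  have h4 : ∫ x, kerOp U d x = -∫ x, d x ^ 2 := by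
    have := hU.integral_mul_kerOp hone hdm
    simp only [one_mul] at this
    rw [this]
    simp only [← hd, sq]
  have i1 := hdm.pow 2
  have i2 := (BddMeas.const 2).mul (hU.bddMeas_kerOp hdm)
  have h5 := (i1.sub i2).integral_le volume h2
  rw [i1.integral_sub i2, integral_const_mul, h4] at h5
  linarith

/-- If the integral operator of an antisymmetric kernel vanishes on all bounded measurable
functions, then the kernel vanishes almost everywhere: `1 + U` and `1` are densities of measures
that agree on rectangles. -/
theorem ae_eq_zero (h : ∀ f : I → ℝ, BddMeas f → ∀ᵐ x, kerOp U f x = 0) :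
    ∀ᵐ z : I × I, U z.1 z.2 = 0 := by
  have hpos : ∀ x y, 0 ≤ 1 + U x y := fun x y => by linarith [(_root_.abs_le.1 (hU.abs_le x y)).1]
  have hbm : BddMeas fun z : I × I => 1 + U z.1 z.2 := (BddMeas.const 1).add hU.bddMeas
  have key : (volume : Measure I).prod (volume : Measure I) =
      (volume : Measure (I × I)).withDensity fun z => ENNReal.ofReal (1 + U z.1 z.2) := by
    refine Measure.prod_eq fun s t hs ht => ?_
    rw [withDensity_apply _ (hs.prod ht), ← ofReal_integral_eq_lintegral_ofReal
      (hbm.integrable _) (ae_of_all _ fun z => hpos z.1 z.2), Measure.volume_eq_prod,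
      setIntegral_prod _ (hbm.integrable _).integrableOn]
    have hin : ∀ᵐ x ∂(volume : Measure I).restrict s,
        ∫ y in t, (1 + U x y) = volume.real t := by
      refine ae_restrict_of_ae ?_
      filter_upwards [h (t.indicator fun _ => 1)
        ⟨measurable_const.indicator ht, 1, fun x => by
          by_cases hx : x ∈ t <;> simp [hx]⟩] with x hx
      have hrow : BddMeas (U x) := hU.bddMeas_comp measurable_const measurable_id
      rw [(BddMeas.const 1).integral_add hrow]
      have : ∫ y in t, U x y = 0 := by
        rw [← integral_indicator ht, ← hx, kerOp]
        refine integral_congr_ae (ae_of_all _ fun y => ?_)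
        by_cases hy : y ∈ t <;> simp [hy]
      rw [this]
      simp
    rw [integral_congr_ae hin]
    simp only [integral_const, smul_eq_mul, measureReal_restrict_apply_univ]
    rw [ENNReal.ofReal_mul measureReal_nonneg, ofReal_measureReal, ofReal_measureReal]
  have h1 : (volume : Measure (I × I)).withDensity (fun _ => 1) =
      (volume : Measure (I × I)).withDensity fun z => ENNReal.ofReal (1 + U z.1 z.2) := by
    rw [← key]
    simp [Measure.volume_eq_prod]
  have h2 := (withDensity_eq_iff_of_sigmaFinite (by fun_prop)
    hbm.measurable.ennreal_ofReal.aemeasurable).1 h1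
  filter_upwards [h2] with z hz
  have := congrArg ENNReal.toReal hz
  rw [ENNReal.toReal_ofReal (hpos _ _)] at this
  simp at this
  exact this

end IsAntisymmKernel

/-! ### The norm of the integral operator -/

theorem BddMeas.sq_integral_le {α : Type*} [MeasurableSpace α] {f : α → ℝ} (hf : BddMeas f)
    (μ : Measure α) [IsProbabilityMeasure μ] : (∫ x, f x ∂μ) ^ 2 ≤ ∫ x, f x ^ 2 ∂μ := by
  set m := ∫ x, f x ∂μ with hm
  have h0 : 0 ≤ ∫ x, (f x ^ 2 - f x * (2 * m) + m ^ 2) ∂μ :=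
    integral_nonneg fun x => by
      have := sq_nonneg (f x - m)
      simp only [Pi.zero_apply]
      nlinarith
  have i1 := hf.pow 2
  have i2 := hf.mul (BddMeas.const (2 * m))
  rw [(i1.sub i2).integral_add (BddMeas.const (m ^ 2)), i1.integral_sub i2, integral_mul_const,
    ← hm] at h0
  simp only [integral_const, probReal_univ, smul_eq_mul] at h0
  nlinarith

/-- A zonoid in the plane satisfies the isoperimetric inequality: averaging the area of the
parallelogram spanned by two independent copies of a random vector `(f, g)` gives at most `2 / π`
times its mean square length. In polar coordinates the area is `r r' |sin (φ - φ')|`, and only the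
constant term in the Fourier expansion of `|sin|` contributes positively. -/
theorem integral_abs_cross_le {α : Type*} [MeasurableSpace α] (μ : Measure α)
    [IsProbabilityMeasure μ] {f g : α → ℝ} (hf : BddMeas f) (hg : BddMeas g) :
    ∫ z : α × α, |f z.1 * g z.2 - f z.2 * g z.1| ∂(μ.prod μ) ≤
      2 / Real.pi * ∫ x, (f x ^ 2 + g x ^ 2) ∂μ := by
  set w : α → ℂ := fun x => ⟨f x, g x⟩ with hw
  have hwm : Measurable w := by
    have : w = fun x => (f x : ℂ) + (g x : ℂ) * Complex.I := by
      funext x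
      simp [hw, Complex.ext_iff]
    rw [this]
    have := hf.measurable
    have := hg.measurable
    fun_prop
  set r : α → ℝ := fun x => ‖w x‖ with hr
  set φ : α → ℝ := fun x => (w x).arg with hφ
  have hφm : Measurable φ := Complex.measurable_arg.comp hwm
  have hf' : ∀ x, f x = r x * Real.cos (φ x) := fun x => (Complex.norm_mul_cos_arg (w x)).symm
  have hg' : ∀ x, g x = r x * Real.sin (φ x) := fun x => (Complex.norm_mul_sin_arg (w x)).symm
  have hrsq : ∀ x, r x ^ 2 = f x ^ 2 + g x ^ 2 := fun x => by
    rw [hf', hg']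
    nlinarith [Real.sin_sq_add_cos_sq (φ x)]
  have hrm : BddMeas r := by
    obtain ⟨B, hB⟩ := hf.bdd
    obtain ⟨B', hB'⟩ := hg.bdd
    refine ⟨hwm.norm, B + B', fun x => ?_⟩
    rw [hr, abs_norm]
    exact (Complex.norm_le_abs_re_add_abs_im _).trans (add_le_add (hB x) (hB' x))
  have hcosm : ∀ n : ℤ, BddMeas fun x => r x * Real.cos (2 * n * φ x) := fun n =>
    hrm.mul ⟨by fun_prop, 1, fun x => Real.abs_cos_le_one _⟩
  have hsinm : ∀ n : ℤ, BddMeas fun x => r x * Real.sin (2 * n * φ x) := fun n =>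
    hrm.mul ⟨by fun_prop, 1, fun x => Real.abs_sin_le_one _⟩
  set a : ℤ → ℝ := fun n => 2 / (Real.pi * (1 - 4 * (n : ℝ) ^ 2)) with ha
  have hasumm : Summable a := by
    have := (hasSum_abs_sin 0).summable
    simpa using this
  set F : ℤ → α × α → ℝ := fun n z =>
    a n * ((r z.1 * Real.cos (2 * n * φ z.1)) * (r z.2 * Real.cos (2 * n * φ z.2)) +
      (r z.1 * Real.sin (2 * n * φ z.1)) * (r z.2 * Real.sin (2 * n * φ z.2))) with hF
  have hcc : ∀ n : ℤ, BddMeas fun z : α × α =>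
      (r z.1 * Real.cos (2 * n * φ z.1)) * (r z.2 * Real.cos (2 * n * φ z.2)) := fun n =>
    ((hcosm n).comp measurable_fst).mul ((hcosm n).comp measurable_snd)
  have hss : ∀ n : ℤ, BddMeas fun z : α × α =>
      (r z.1 * Real.sin (2 * n * φ z.1)) * (r z.2 * Real.sin (2 * n * φ z.2)) := fun n =>
    ((hsinm n).comp measurable_fst).mul ((hsinm n).comp measurable_snd)
  have hFcos : ∀ n z, F n z = r z.1 * r z.2 * (a n * Real.cos (2 * n * (φ z.2 - φ z.1))) := by
    intro n z
    rw [mul_sub, Real.cos_sub]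
    simp only [hF]
    ring
  have hFm : ∀ n, BddMeas (F n) := fun n => (BddMeas.const (a n)).mul ((hcc n).add (hss n))
  have hFint : ∀ n, ∫ z, F n z ∂(μ.prod μ) =
      a n * ((∫ x, r x * Real.cos (2 * n * φ x) ∂μ) ^ 2 +
        (∫ x, r x * Real.sin (2 * n * φ x) ∂μ) ^ 2) := by
    intro n
    simp only [hF]
    rw [integral_const_mul, (hcc n).integral_add (hss n),
      integral_prod_mul (μ := μ) (ν := μ) (fun x => r x * Real.cos (2 * n * φ x))
        (fun x => r x * Real.cos (2 * n * φ x)),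
      integral_prod_mul (μ := μ) (ν := μ) (fun x => r x * Real.sin (2 * n * φ x))
        (fun x => r x * Real.sin (2 * n * φ x))]
    ring
  have hFsumm : Summable fun n => ∫ z, ‖F n z‖ ∂(μ.prod μ) := by
    obtain ⟨B, hB⟩ := hrm.bdd
    refine Summable.of_nonneg_of_le (fun n => integral_nonneg fun z => norm_nonneg _)
      (fun n => ?_) (hasumm.norm.mul_left (B * B))
    refine (hFm n).abs.integral_le _ fun z => ?_
    rw [hFcos, abs_mul, abs_mul, abs_mul, Real.norm_eq_abs]
    have hB0 : 0 ≤ B := (abs_nonneg _).trans (hB z.1)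
    exact mul_le_mul (mul_le_mul (hB _) (hB _) (abs_nonneg _) hB0)
      (mul_le_of_le_one_right (abs_nonneg _) (Real.abs_cos_le_one _))
      (mul_nonneg (abs_nonneg _) (abs_nonneg _)) (mul_nonneg hB0 hB0)
  have hsum := hasSum_integral_of_summable_integral_norm
    (fun n => (hFm n).integrable (μ.prod μ)) hFsumm
  have htsum : ∀ z, ∑' n, F n z = |f z.1 * g z.2 - f z.2 * g z.1| := by
    intro z
    have h1 := ((hasSum_abs_sin (φ z.2 - φ z.1)).mul_left (r z.1 * r z.2)).tsum_eq
    simp only [hFcos]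
    rw [h1, Real.sin_sub, hf', hf', hg', hg']
    rw [← abs_of_nonneg (mul_nonneg (norm_nonneg (w z.1)) (norm_nonneg (w z.2))), ← abs_mul]
    congr 1
    simp only [hr]
    ring
  simp only [htsum] at hsum
  have hr2 : ∫ x, (f x ^ 2 + g x ^ 2) ∂μ = ∫ x, r x ^ 2 ∂μ := by simp only [hrsq]
  rw [hr2]
  refine hasSum_le (fun n => ?_) hsum (hasSum_ite_eq (0 : ℤ) (2 / Real.pi * ∫ x, r x ^ 2 ∂μ))
  rw [hFint]
  have hpi := Real.pi_pos
  split_ifs with h0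
  · subst h0
    simp only [ha, Int.cast_zero, mul_zero, zero_mul, Real.cos_zero, Real.sin_zero, mul_one,
      integral_zero]
    norm_num
    exact mul_le_mul_of_nonneg_left (hrm.sq_integral_le μ) (by positivity)
  · refine mul_nonpos_of_nonpos_of_nonneg ?_ (by positivity)
    have h1 : (1 : ℝ) ≤ (n : ℝ) ^ 2 := by
      have : (1 : ℤ) ≤ n ^ 2 := by
        have := sq_nonneg n
        have : n ^ 2 ≠ 0 := pow_ne_zero 2 h0
        omega
      exact_mod_cast this
    exact div_nonpos_of_nonneg_of_nonpos (by norm_num)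
      (mul_nonpos_of_nonneg_of_nonpos hpi.le (by linarith))

namespace IsAntisymmKernel

variable {U : I → I → ℝ} (hU : IsAntisymmKernel U)
include hU

/-- The bilinear form of an antisymmetric kernel only sees the antisymmetrisation
`f x * g y - f y * g x`. -/
theorem two_pi_mul_integral_mul_kerOp_le {f g : I → ℝ} (hf : BddMeas f) (hg : BddMeas g) :
    2 * Real.pi * ∫ x, f x * kerOp U g x ≤ ∫ x, (f x ^ 2 + g x ^ 2) := by
  have hint : BddMeas fun z : I × I => f z.1 * (U z.1 z.2 * g z.2) :=
    (hf.comp measurable_fst).mul (hU.bddMeas.mul (hg.comp measurable_snd))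
  have hint' : BddMeas fun z : I × I => g z.1 * (U z.1 z.2 * f z.2) :=
    (hg.comp measurable_fst).mul (hU.bddMeas.mul (hf.comp measurable_snd))
  have h1 : ∫ z : I × I, f z.1 * (U z.1 z.2 * g z.2) = ∫ x, f x * kerOp U g x := by
    rw [Measure.volume_eq_prod, integral_prod _ (hint.integrable _)]
    simp only [kerOp, integral_const_mul]
  have h2 : ∫ z : I × I, g z.1 * (U z.1 z.2 * f z.2) = -∫ x, f x * kerOp U g x := by
    rw [Measure.volume_eq_prod, integral_prod _ (hint'.integrable _),
      hU.integral_mul_kerOp hf hg, neg_neg]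
    simp only [kerOp, integral_const_mul, mul_comm]
  have hcross : BddMeas fun z : I × I => |f z.1 * g z.2 - f z.2 * g z.1| :=
    (((hf.comp measurable_fst).mul (hg.comp measurable_snd)).sub
      ((hf.comp measurable_snd).mul (hg.comp measurable_fst))).abs
  have h3 : 2 * ∫ x, f x * kerOp U g x ≤
      ∫ z : I × I, 1 / 2 * |f z.1 * g z.2 - f z.2 * g z.1| := by
    have : 2 * ∫ x, f x * kerOp U g x =
        ∫ z : I × I, (f z.1 * (U z.1 z.2 * g z.2) - g z.1 * (U z.1 z.2 * f z.2)) := by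
      rw [hint.integral_sub hint', h1, h2]
      ring
    rw [this]
    refine (hint.sub hint').integral_mono ((BddMeas.const _).mul hcross) _ fun z => ?_
    calc _ = U z.1 z.2 * (f z.1 * g z.2 - f z.2 * g z.1) := by ring
      _ ≤ |U z.1 z.2| * |f z.1 * g z.2 - f z.2 * g z.1| := by
        rw [← abs_mul]; exact le_abs_self _
      _ ≤ _ := mul_le_mul_of_nonneg_right (hU.abs_le _ _) (abs_nonneg _)
  rw [integral_const_mul] at h3
  have h4 := integral_abs_cross_le (volume : Measure I) hf hg
  rw [← Measure.volume_eq_prod] at h4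
  have hpi := Real.pi_pos
  rw [div_mul_eq_mul_div, le_div_iff₀ hpi] at h4
  nlinarith

/-- The integral operator of an antisymmetric kernel has norm at most `1 / π`. -/
theorem integral_sq_kerOp_le {f : I → ℝ} (hf : BddMeas f) :
    Real.pi ^ 2 * ∫ x, kerOp U f x ^ 2 ≤ ∫ x, f x ^ 2 := by
  set G := ∫ x, kerOp U f x ^ 2 with hG
  set A := ∫ x, f x ^ 2 with hA
  have hKf := hU.bddMeas_kerOp hf
  -- Testing against `T f` and rescaling `f` by `s` gives a quadratic in `s` without sign change;
  -- its discriminant yields the claim.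
  have key : ∀ s : ℝ, 0 ≤ A * (s * s) + (-(2 * Real.pi * G)) * s + G := by
    intro s
    have h := hU.two_pi_mul_integral_mul_kerOp_le hKf ((BddMeas.const s).mul hf)
    have h1 : ∀ x, kerOp U (fun y => s * f y) x = s * kerOp U f x := fun x => by
      simp only [kerOp, ← integral_const_mul]
      congr 1
      funext y
      ring
    have h2 : ∫ x, kerOp U f x * kerOp U (fun y => s * f y) x = s * G := by
      rw [hG, ← integral_const_mul]
      congr 1
      funext x
      rw [h1]
      ring
    have h3 : ∫ x, (kerOp U f x ^ 2 + (s * f x) ^ 2) = G + s ^ 2 * A := by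
      rw [(hKf.pow 2).integral_add (((BddMeas.const s).mul hf).pow 2), hA, ← integral_const_mul]
      simp only [mul_pow, ← hG]
    rw [h2, h3] at h
    nlinarith
  have hd := discrim_le_zero key
  have hG0 : 0 ≤ G := integral_nonneg fun x => sq_nonneg _
  rcases hG0.eq_or_lt with h0 | h0
  · rw [← h0, mul_zero]
    exact integral_nonneg fun x => sq_nonneg _
  · have h5 : (Real.pi ^ 2 * G) * G ≤ A * G := by
      rw [discrim] at hd
      nlinarith
    exact le_of_mul_le_mul_right h5 h0

/-- Since the operator is normal, an iterate of it annihilates a function only if the operator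
itself does. -/
theorem kerOp_ae_eq_zero_of_iterate {f : I → ℝ} (hf : BddMeas f) {n : ℕ}
    (h : ∀ᵐ x, (kerOp U)^[n + 1] f x = 0) : ∀ᵐ x, kerOp U f x = 0 := by
  induction n with
  | zero => simpa using h
  | succ n ih =>
    apply ih
    have hm := hU.bddMeas_kerOp_iterate hf (n + 1)
    have h0 : ∫ x, (kerOp U)^[n + 1] f x ^ 2 = 0 := by
      have h1 := hU.integral_mul_kerOp (hU.bddMeas_kerOp_iterate hf n) hm
      rw [← Function.iterate_succ_apply' (kerOp U), ← Function.iterate_succ_apply' (kerOp U)] at h1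
      have h2 : ∫ x, (kerOp U)^[n] f x * (kerOp U)^[n + 1 + 1] f x = 0 := by
        refine integral_eq_zero_of_ae ?_
        filter_upwards [h] with x hx
        rw [hx]
        simp
      rw [h2] at h1
      simp only [sq]
      linarith
    have h3 := (integral_eq_zero_iff_of_nonneg (fun x => sq_nonneg _)
      ((hm.pow 2).integrable _)).1 h0
    filter_upwards [h3] with x hx
    simpa using hx

/-- If an iterate of the operator annihilates almost all columns of the kernel, then the kernel
vanishes almost everywhere. -/
theorem ae_eq_zero_of_iterate_column {n : ℕ}
    (h : ∀ᵐ x, ∀ᵐ y, (kerOp U)^[n + 1] (fun z => U z x) y = 0) :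
    ∀ᵐ z : I × I, U z.1 z.2 = 0 := by
  refine hU.ae_eq_zero fun f hf => ?_
  refine hU.kerOp_ae_eq_zero_of_iterate hf (n := 1) ?_
  filter_upwards [h] with x hx
  have hcol : BddMeas fun z => U z x := hU.bddMeas_comp measurable_id measurable_const
  have h1 := hU.kerOp_ae_eq_zero_of_iterate hcol hx
  have h2 := hU.integral_mul_kerOp hf hcol
  have h3 : ∫ y, f y * kerOp U (fun z => U z x) y = 0 := by
    refine integral_eq_zero_of_ae ?_
    filter_upwards [h1] with y hy
    rw [hy]
    simp
  rw [h3] at h2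
  -- By antisymmetry, `T (T f) x` is the inner product of `f` with `T U(·, x)`.
  change kerOp U (kerOp U f) x = 0
  rw [h2, ← integral_neg, kerOp]
  congr 1
  funext y
  rw [hU.antisymm x y]
  ring

end IsAntisymmKernel

/-! ### Integrals over walks -/

namespace IsAntisymmKernel

variable {U : I → I → ℝ} (hU : IsAntisymmKernel U)
include hU

/-- The integral over all walks with `m` steps, weighted by a function of the two end points, is up to
sign the trace of the kernel obtained by applying the operator `m` times to that function. -/
theorem integral_path (m : ℕ) {h : I → I → ℝ} (hh : BddMeas fun z : I × I => h z.1 z.2) :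
    ∫ x : Fin (m + 1) → I, (∏ i : Fin m, U (x i.castSucc) (x i.succ)) * h (x 0) (x (Fin.last m)) =
      (-1) ^ m * ∫ y, (kerOp U)^[m] (fun z => h z y) y := by
  induction m generalizing h with
  | zero =>
    have := (volume_preserving_funUnique (Fin 1) I).integral_comp'
      (g := fun y => h y y)
    simp only [Finset.univ_eq_empty, Finset.prod_empty, one_mul, pow_zero, Function.iterate_zero,
      id_eq]
    rw [← this]
    rfl
  | succ m ih =>
    -- Integrating out the first vertex replaces `h(·, y)` by `-T h(·, y)`.
    have hpres := (volume_preserving_piFinSuccAbove (fun _ : Fin (m + 1 + 1) => I) 0).symm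
    rw [← hpres.integral_comp']
    have hin : BddMeas fun z : I × I => -kerOp U (fun w => h w z.2) z.1 := by
      have := hU.bddMeas_kerOp_family (α := I) (h := fun y w => h w y)
        (hh.comp (φ := Prod.swap) measurable_swap)
      exact (this.comp (φ := Prod.swap) measurable_swap).neg
    have hbig : BddMeas fun q : I × (Fin (m + 1) → I) =>
        U q.1 (q.2 0) * ((∏ i : Fin m, U (q.2 i.castSucc) (q.2 i.succ)) *
          h q.1 (q.2 (Fin.last m))) :=
      (hU.bddMeas_comp (by fun_prop) (by fun_prop)).mul
        ((BddMeas.prod _ fun i _ => hU.bddMeas_comp (by fun_prop) (by fun_prop)).mul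
          (hh.comp (φ := fun q : I × (Fin (m + 1) → I) => (q.1, q.2 (Fin.last m))) (by fun_prop)))
    have h1 : ∀ q : I × (Fin (m + 1) → I),
        (∏ i : Fin (m + 1), U
          ((MeasurableEquiv.piFinSuccAbove (fun _ : Fin (m + 1 + 1) => I) 0).symm q i.castSucc)
          ((MeasurableEquiv.piFinSuccAbove (fun _ : Fin (m + 1 + 1) => I) 0).symm q i.succ)) *
          h ((MeasurableEquiv.piFinSuccAbove (fun _ : Fin (m + 1 + 1) => I) 0).symm q 0)
            ((MeasurableEquiv.piFinSuccAbove (fun _ : Fin (m + 1 + 1) => I) 0).symm q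
              (Fin.last (m + 1))) =
        U q.1 (q.2 0) * ((∏ i : Fin m, U (q.2 i.castSucc) (q.2 i.succ)) *
          h q.1 (q.2 (Fin.last m))) := by
      rintro ⟨a, x⟩
      have e0 : (MeasurableEquiv.piFinSuccAbove (fun _ : Fin (m + 1 + 1) => I) 0).symm (a, x) =
          Fin.cons a x := by
        funext i
        simp [MeasurableEquiv.piFinSuccAbove, Fin.insertNthEquiv]
      rw [e0, Fin.prod_univ_succ]
      simp only [Fin.castSucc_zero, Fin.cons_zero, Fin.cons_succ, ← Fin.succ_castSucc,
        ← Fin.succ_last]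
      ring
    simp only [h1]
    rw [Measure.volume_eq_prod, integral_prod_symm _ (hbig.integrable _)]
    have h2 : ∀ x : Fin (m + 1) → I,
        ∫ a, U a (x 0) * ((∏ i : Fin m, U (x i.castSucc) (x i.succ)) * h a (x (Fin.last m))) =
        (∏ i : Fin m, U (x i.castSucc) (x i.succ)) *
          (-kerOp U (fun w => h w (x (Fin.last m))) (x 0)) := by
      intro x
      rw [kerOp, ← integral_neg, ← integral_const_mul]
      congr 1
      funext a
      rw [hU.antisymm (x 0) a]
      ring
    simp only [h2]
    rw [ih (h := fun z y => -kerOp U (fun w => h w y) z) hin, pow_succ]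
    have hneg : ∀ f : I → ℝ, ∀ n : ℕ, (kerOp U)^[n] (fun z => -f z) =
        fun z => -(kerOp U)^[n] f z := by
      intro f n
      induction n with
      | zero => rfl
      | succ n ihn =>
        rw [Function.iterate_succ_apply', ihn, Function.iterate_succ_apply']
        funext z
        simp [kerOp, integral_neg]
    simp only [hneg, integral_neg, Function.iterate_succ_apply]
    ring_nf

theorem integral_path_one (m : ℕ) :
    ∫ x : Fin (m + 1) → I, ∏ i : Fin m, U (x i.castSucc) (x i.succ) =
      (-1) ^ m * ∫ y, (kerOp U)^[m] (fun _ => 1) y := by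
  simpa using hU.integral_path m (h := fun _ _ => 1) (BddMeas.const 1)

/-- Reversing the direction of a walk of odd length changes the sign of its weight. -/
theorem integral_path_odd {m : ℕ} (hm : Odd m) :
    ∫ x : Fin (m + 1) → I, ∏ i : Fin m, U (x i.castSucc) (x i.succ) = 0 := by
  have h1 := hU.integral_mul_kerOp_iterate (BddMeas.const 1) (BddMeas.const 1) m
  simp only [one_mul, mul_one, hm.neg_one_pow] at h1
  rw [hU.integral_path_one, hm.neg_one_pow]
  linarith

theorem integral_path_even (n : ℕ) :
    ∫ x : Fin (2 * n + 1) → I, ∏ i : Fin (2 * n), U (x i.castSucc) (x i.succ) =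
      (-1) ^ n * ∫ y, (kerOp U)^[n] (fun _ => 1) y ^ 2 := by
  have hone : BddMeas fun _ : I => (1 : ℝ) := BddMeas.const 1
  have h1 := hU.integral_mul_kerOp_iterate hone (hU.bddMeas_kerOp_iterate hone n) n
  rw [hU.integral_path_one, (even_two_mul n).neg_one_pow, one_mul, two_mul]
  simp only [one_mul, ← Function.iterate_add_apply, ← sq] at h1
  exact h1

/-- The integral over closed walks of even length, as a sum of squares. -/
theorem integral_cycle (n : ℕ) :
    ∫ x : Fin (2 * n + 1 + 1) → I, (∏ i : Fin (2 * n + 1), U (x i.castSucc) (x i.succ)) *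
        U (x (Fin.last _)) (x 0) =
      (-1) ^ (n + 1) * ∫ y, ∫ z, (kerOp U)^[n] (fun w => U w y) z ^ 2 := by
  rw [hU.integral_path (2 * n + 1) (h := fun a b => U b a)
    (hU.bddMeas.comp (φ := Prod.swap) measurable_swap), pow_succ, pow_succ,
    (even_two_mul n).neg_one_pow, one_mul, neg_one_mul, mul_neg_one, neg_mul, ← integral_neg,
    ← neg_mul, ← integral_const_mul]
  congr 1
  funext y
  have hcol : BddMeas (U y) := hU.bddMeas_comp measurable_const measurable_id
  have hc : ∀ n : ℕ, ((kerOp U)^[n] fun w => U w y) = fun z => -(kerOp U)^[n] (U y) z := by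
    intro n
    induction n with
    | zero => funext z; exact hU.antisymm y z
    | succ n ih =>
      rw [Function.iterate_succ_apply', ih, Function.iterate_succ_apply']
      funext z
      simp [kerOp, integral_neg]
  have h1 := hU.integral_mul_kerOp_iterate hcol (hU.bddMeas_kerOp_iterate hcol n) n
  simp only [hc]
  rw [Function.iterate_succ_apply', kerOp, two_mul]
  simp only [← Function.iterate_add_apply] at h1
  rw [h1]
  simp only [sq, neg_mul_neg]
  ring

end IsAntisymmKernel

/-! ### Homomorphism densities of oriented graphs -/

/-- Restricting a uniformly random point of `[0,1]^V` to a subset of the coordinates gives a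
uniformly random point. -/
theorem measurePreserving_comp_embedding {V W : Type*} [Fintype V] [Fintype W] (f : W ↪ V) :
    MeasurePreserving (fun (x : V → I) (w : W) => x (f w)) volume volume := by
  classical
  refine ⟨by fun_prop, ?_⟩
  refine (Measure.pi_eq fun s hs => ?_).symm
  rw [Measure.map_apply (by fun_prop) (MeasurableSet.univ_pi hs)]
  set t : V → Set I := fun v => ⋂ (w : W) (_ : f w = v), s w with ht
  have h1 : (fun (x : V → I) (w : W) => x (f w)) ⁻¹' Set.univ.pi s = Set.univ.pi t := by
    ext x
    simp only [Set.mem_preimage, Set.mem_pi, Set.mem_univ, true_imp_iff, ht, Set.mem_iInter]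
    exact ⟨fun h v w hw => hw ▸ h w, fun h w => h _ w rfl⟩
  rw [h1, volume_pi, Measure.pi_pi]
  refine (Fintype.prod_of_injective f f.injective _ _ (fun v hv => ?_) fun w => ?_).symm
  · have : t v = Set.univ := by
      simp only [ht, Set.iInter_eq_univ]
      exact fun w hw => (hv ⟨w, hw⟩).elim
    rw [this, measure_univ]
  · congr 1
    ext y
    simp only [ht, Set.mem_iInter]
    exact ⟨fun h w' hw' => f.injective hw' ▸ h, fun h => h w rfl⟩

theorem measurePreserving_piCurry {ι : Type*} [Fintype ι] {V : ι → Type*} [∀ i, Fintype (V i)] :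
    MeasurePreserving (MeasurableEquiv.piCurry fun (i : ι) (_ : V i) => I) volume volume := by
  refine ⟨MeasurableEquiv.measurable _, ?_⟩
  have h := Measure.infinitePi_map_piCurry (X := fun (i : ι) (_ : V i) => I)
    (fun _ _ => (volume : Measure I))
  simp only [Measure.infinitePi_eq_pi] at h
  exact h

namespace OrientedGraph

theorem disjoint_sdiff_swap {V : Type*} [DecidableEq V] (H : OrientedGraph V)
    {R : Finset (V × V)} (hR : R ⊆ H.edges) : Disjoint (H.edges \ R) (R.image Prod.swap) := by
  rw [Finset.disjoint_left]
  rintro ⟨a, b⟩ h1 h2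
  obtain ⟨⟨c, d⟩, hcd, heq⟩ := Finset.mem_image.1 h2
  obtain ⟨rfl, rfl⟩ := Prod.mk.inj heq
  exact H.asymm _ _ (hR hcd) (Finset.mem_sdiff.1 h1).1

theorem mem_reverse {V : Type*} [DecidableEq V] {H : OrientedGraph V} {R : Finset (V × V)}
    {a b : V} : (a, b) ∈ (H.reverse R).edges ↔
      ((a, b) ∈ H.edges ∧ (a, b) ∉ R) ∨ ((b, a) ∈ H.edges ∧ (b, a) ∈ R) := by
  simp only [reverse, Finset.mem_union, Finset.mem_sdiff, Finset.mem_image, Finset.mem_inter,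
    Prod.exists, Prod.swap_prod_mk, Prod.mk.injEq]
  constructor
  · rintro (h | ⟨c, d, h, rfl, rfl⟩)
    · exact Or.inl h
    · exact Or.inr h
  · rintro (h | h)
    · exact Or.inl h
    · exact Or.inr ⟨b, a, h, rfl, rfl⟩

section Density

variable {V W : Type*} [Fintype V] [Fintype W] {U : I → I → ℝ} (hU : IsAntisymmKernel U)
include hU

omit [Fintype V] in
theorem bddMeas_prod_edges (s : Finset (V × V)) :
    BddMeas fun x : V → I => ∏ e ∈ s, U (x e.1) (x e.2) :=
  BddMeas.prod _ fun _ _ => hU.bddMeas_comp (measurable_pi_apply _) (measurable_pi_apply _)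

theorem homDensity_eq_of_isCopy {H : OrientedGraph W} {G : OrientedGraph V}
    (h : H.IsCopyWithIsolated G) : G.homDensity U = H.homDensity U := by
  obtain ⟨f, hf⟩ := h
  have hmp := measurePreserving_comp_embedding (V := V) (W := W) f
  rw [homDensity, homDensity, ← hmp.map_eq, integral_map hmp.measurable.aemeasurable
    (bddMeas_prod_edges hU _).measurable.aestronglyMeasurable, hf]
  simp only [Finset.prod_map, Function.Embedding.coe_prodMap, Prod.map_fst, Prod.map_snd]

theorem homDensity_reverse [DecidableEq V] (H : OrientedGraph V) {R : Finset (V × V)}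
    (hR : R ⊆ H.edges) : (H.reverse R).homDensity U = (-1) ^ R.card * H.homDensity U := by
  rw [homDensity, homDensity, ← integral_const_mul]
  congr 1
  funext x
  simp only [reverse]
  rw [Finset.inter_eq_right.2 hR, Finset.prod_union (disjoint_sdiff_swap H hR),
    Finset.prod_image Prod.swap_injective.injOn, ← Finset.prod_sdiff hR]
  have : ∏ e ∈ R, U (x e.swap.1) (x e.swap.2) = (-1) ^ R.card * ∏ e ∈ R, U (x e.1) (x e.2) := by
    rw [← Finset.prod_const, ← Finset.prod_mul_distrib]
    refine Finset.prod_congr rfl fun e _ => ?_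
    rw [Prod.fst_swap, Prod.snd_swap, hU.antisymm (x e.1) (x e.2), neg_one_mul]
  rw [this]
  ring

omit hU in
theorem homDensity_disjointUnion {ι : Type*} [Fintype ι] {V : ι → Type*} [∀ i, Fintype (V i)]
    (H : ∀ i, OrientedGraph (V i)) (U : I → I → ℝ) :
    (disjointUnion H).homDensity U = ∏ i, (H i).homDensity U := by
  simp only [homDensity]
  rw [← integral_fintype_prod_volume_eq_prod
    (fun i (y : V i → I) => ∏ e ∈ (H i).edges, U (y e.1) (y e.2)),
    ← (measurePreserving_piCurry (ι := ι) (V := V)).integral_comp']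
  simp only [disjointUnion, Finset.prod_map, Finset.prod_sigma]
  rfl

end Density

/-- The path with `m` edges, all oriented in the same direction. -/
def path (m : ℕ) : OrientedGraph (Fin (m + 1)) where
  edges := Finset.univ.image fun i : Fin m => (i.castSucc, i.succ)
  asymm u v h h' := by
    simp only [Finset.mem_image, Finset.mem_univ, true_and, Prod.mk.injEq] at h h'
    obtain ⟨i, rfl, rfl⟩ := h
    obtain ⟨j, h1, h2⟩ := h'
    simp only [Fin.ext_iff, Fin.val_castSucc, Fin.val_succ] at h1 h2
    omega

theorem homDensity_path (m : ℕ) (U : I → I → ℝ) :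
    (path m).homDensity U = ∫ x : Fin (m + 1) → I, ∏ i : Fin m, U (x i.castSucc) (x i.succ) := by
  simp only [homDensity, path]
  congr 1
  funext x
  rw [Finset.prod_image]
  rintro i - j - h
  exact Fin.castSucc_injective _ (Prod.mk.inj h).1

theorem injective_step {m : ℕ} (p : Fin m → Prop) [DecidablePred p] :
    Function.Injective fun i : Fin m =>
      if p i then (i.castSucc, i.succ) else (i.succ, i.castSucc) := by
  intro i j hij
  simp only at hij
  split_ifs at hij <;> simp only [Prod.mk.injEq, Fin.ext_iff, Fin.val_castSucc, Fin.val_succ]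
    at hij <;> ext <;> omega

theorem Q_edges (n : ℕ) : (Q n).edges = Finset.univ.image fun i : Fin (2 * n) =>
    if n ≤ (i : ℕ) then (i.castSucc, i.succ) else (i.succ, i.castSucc) := by
  ext ⟨a, b⟩
  simp only [Q, Finset.mem_filter, Finset.mem_univ, true_and, Finset.mem_image]
  constructor
  · rintro (⟨h1, h2⟩ | ⟨h1, h2⟩)
    · refine ⟨⟨a, by omega⟩, ?_⟩
      rw [if_pos (by simp only; omega)]
      ext <;> simp [h2]
    · refine ⟨⟨b, by omega⟩, ?_⟩
      rw [if_neg (by simp only; omega)]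
      ext <;> simp [h2]
  · rintro ⟨i, hi⟩
    split_ifs at hi with h
    · obtain ⟨rfl, rfl⟩ := Prod.mk.inj hi
      left; simp; omega
    · obtain ⟨rfl, rfl⟩ := Prod.mk.inj hi
      right; simp; omega

theorem card_Q_edges (n : ℕ) : (Q n).edges.card = 2 * n := by
  rw [Q_edges, Finset.card_image_of_injective _ (injective_step _), Finset.card_univ,
    Fintype.card_fin]

/-- The edges of `D (n + 1)` are those of a reoriented walk `0, 1, …, 2n + 1` together with a closing
edge. The ascription identifies `Fin (2 * (n + 1))` with `Fin (2 * n + 1 + 1)`. -/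
theorem D_edges (n : ℕ) :
    ((D (n + 1)).edges : Finset (Fin (2 * n + 1 + 1) × Fin (2 * n + 1 + 1))) =
      insert ((0 : Fin (2 * n + 1 + 1)), Fin.last (2 * n + 1))
        (Finset.univ.image fun i : Fin (2 * n + 1) =>
          if (i : ℕ) < n + 1 then (i.castSucc, i.succ) else (i.succ, i.castSucc)) := by
  have hmem : ∀ a b : Fin (2 * n + 1 + 1),
      (a, b) ∈ ((D (n + 1)).edges : Finset (Fin (2 * n + 1 + 1) × Fin (2 * n + 1 + 1))) ↔
      ((a : ℕ) < n + 1 ∧ (b : ℕ) = a + 1) ∨ (n + 1 ≤ (b : ℕ) ∧ (a : ℕ) = b + 1) ∨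
      ((a : ℕ) = 0 ∧ (b : ℕ) = 2 * (n + 1) - 1) :=
    fun a b => Finset.mem_filter.trans (and_iff_right (Finset.mem_univ _))
  ext ⟨a, b⟩
  rw [hmem]
  simp only [Finset.mem_univ, true_and, Finset.mem_insert, Finset.mem_image,
    Prod.mk.injEq, Fin.ext_iff, Fin.val_zero, Fin.val_last]
  constructor
  · rintro (⟨h1, h2⟩ | ⟨h1, h2⟩ | ⟨h1, h2⟩)
    · refine Or.inr ⟨⟨a, by omega⟩, ?_⟩
      rw [if_pos (by simp only; omega)]
      ext <;> simp [h2]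
    · refine Or.inr ⟨⟨b, by omega⟩, ?_⟩
      rw [if_neg (by simp only; omega)]
      ext <;> simp [h2]
    · exact Or.inl ⟨h1, by omega⟩
  · rintro (⟨h1, h2⟩ | ⟨i, hi⟩)
    · right; right; omega
    · split_ifs at hi with h
      · obtain ⟨rfl, rfl⟩ := Prod.mk.inj hi
        left; simp; omega
      · obtain ⟨rfl, rfl⟩ := Prod.mk.inj hi
        right; left; simp; omega

/-- This fails for `n = 0`, where the walk and the closing edge coincide. -/
theorem closing_edge_notMem {n : ℕ} (hn : 1 ≤ n) :
    ((0 : Fin (2 * n + 1 + 1)), Fin.last (2 * n + 1)) ∉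
      Finset.univ.image fun i : Fin (2 * n + 1) =>
        if (i : ℕ) < n + 1 then (i.castSucc, i.succ) else (i.succ, i.castSucc) := by
  simp only [Finset.mem_image, Finset.mem_univ, true_and, not_exists]
  intro i hi
  split_ifs at hi <;> simp only [Prod.mk.injEq, Fin.ext_iff, Fin.val_castSucc, Fin.val_succ,
    Fin.val_zero, Fin.val_last] at hi <;> omega

theorem card_D_edges {n : ℕ} (hn : 1 ≤ n) : (D (n + 1)).edges.card = 2 * (n + 1) := by
  have h := congrArg Finset.card (D_edges n)
  rw [Finset.card_insert_of_notMem (closing_edge_notMem hn),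
    Finset.card_image_of_injective _ (injective_step _), Finset.card_univ, Fintype.card_fin] at h
  exact h

section Walks

variable {U : I → I → ℝ} (hU : IsAntisymmKernel U)
include hU

/-- Reorienting the edges of a walk contributes one sign per reversed edge. -/
theorem prod_step {m : ℕ} (p : Fin m → Prop) [DecidablePred p] (x : Fin (m + 1) → I) :
    ∏ e ∈ Finset.univ.image fun i : Fin m =>
        if p i then (i.castSucc, i.succ) else (i.succ, i.castSucc), U (x e.1) (x e.2) =
      (-1) ^ (Finset.univ.filter fun i => ¬ p i).card *
        ∏ i : Fin m, U (x i.castSucc) (x i.succ) := by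
  rw [Finset.prod_image (injective_step p).injOn]
  calc _ = ∏ i : Fin m, (if p i then (1 : ℝ) else -1) * U (x i.castSucc) (x i.succ) := by
        refine Finset.prod_congr rfl fun i _ => ?_
        split_ifs
        · rw [one_mul]
        · rw [hU.antisymm (x i.castSucc), neg_one_mul]
    _ = _ := by
        rw [Finset.prod_mul_distrib, Finset.prod_ite, Finset.prod_const_one, Finset.prod_const,
          one_mul]

theorem homDensity_path_odd {m : ℕ} (hm : Odd m) : (path m).homDensity U = 0 := by
  rw [homDensity_path, hU.integral_path_odd hm]

theorem homDensity_Q (n : ℕ) :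
    (Q n).homDensity U = ∫ y, (kerOp U)^[n] (fun _ => 1) y ^ 2 := by
  have hcard : (Finset.univ.filter fun i : Fin (2 * n) => ¬ n ≤ (i : ℕ)).card = n := by
    simp only [not_le]
    rw [Fin.card_filter_val_lt]
    omega
  simp only [homDensity, Q_edges, prod_step hU, hcard]
  rw [integral_const_mul, hU.integral_path_even, ← mul_assoc, ← mul_pow]
  simp

theorem homDensity_D {n : ℕ} (hn : 1 ≤ n) :
    (D (n + 1)).homDensity U = ∫ y, ∫ z, (kerOp U)^[n] (fun w => U w y) z ^ 2 := by
  have hcard : (Finset.univ.filter fun i : Fin (2 * n + 1) => ¬ (i : ℕ) < n + 1).card = n := by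
    have h1 := Finset.card_filter_add_card_filter_not (s := Finset.univ)
      fun i : Fin (2 * n + 1) => (i : ℕ) < n + 1
    rw [Fin.card_filter_val_lt, Finset.card_univ, Fintype.card_fin] at h1
    omega
  obtain ⟨E, hE, hE'⟩ : ∃ E : Finset (Fin (2 * n + 1 + 1) × Fin (2 * n + 1 + 1)),
      (D (n + 1)).edges = E ∧ E = _ := ⟨_, D_edges n, rfl⟩
  have hprod : ∀ x : Fin (2 * n + 1 + 1) → I, ∏ e ∈ E, U (x e.1) (x e.2) =
      (-1) ^ (n + 1) * ((∏ i : Fin (2 * n + 1), U (x i.castSucc) (x i.succ)) *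
        U (x (Fin.last _)) (x 0)) := by
    intro x
    rw [hE', Finset.prod_insert (closing_edge_notMem hn), prod_step hU, hcard,
      hU.antisymm (x (Fin.last _)) (x 0), pow_succ]
    ring
  have h1 : (D (n + 1)).homDensity U =
      ∫ x : Fin (2 * n + 1 + 1) → I, ∏ e ∈ E, U (x e.1) (x e.2) := by
    rw [← hE]
    rfl
  rw [h1]
  simp only [hprod]
  rw [integral_const_mul, hU.integral_cycle, ← mul_assoc, ← mul_pow]
  simp

end Walks

end OrientedGraph

/-! ### Underlying graphs and unions of paths -/

namespace OrientedGraph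

variable {V W : Type*}

theorem card_reverse [DecidableEq V] (H : OrientedGraph V) {R : Finset (V × V)}
    (hR : R ⊆ H.edges) : (H.reverse R).edges.card = H.edges.card := by
  simp only [reverse]
  rw [Finset.inter_eq_right.2 hR, Finset.card_union_of_disjoint (disjoint_sdiff_swap H hR),
    Finset.card_image_of_injective _ Prod.swap_injective, Finset.card_sdiff_add_card_eq_card hR]

/-- The underlying graph of `G` is the image under `f` of the underlying graph of `H`. -/
def IsUnderlyingCopy (H : OrientedGraph W) (G : OrientedGraph V) (f : W ↪ V) : Prop :=
  ∀ a b, G.toSimpleGraph.Adj a b ↔ ∃ u v, H.toSimpleGraph.Adj u v ∧ f u = a ∧ f v = b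

/-- Oriented graphs with the same underlying graph arise from one another by reversing edges. -/
theorem IsUnderlyingCopy.exists_reverse [DecidableEq W] {H : OrientedGraph W}
    {G : OrientedGraph V} {f : W ↪ V} (h : IsUnderlyingCopy H G f) :
    ∃ R ⊆ H.edges, G.edges = (H.reverse R).edges.map (f.prodMap f) := by
  classical
  refine ⟨H.edges.filter fun e => (f e.2, f e.1) ∈ G.edges, Finset.filter_subset _ _, ?_⟩
  ext ⟨a, b⟩
  simp only [Finset.mem_map, Prod.exists, mem_reverse, Finset.mem_filter,
    Function.Embedding.coe_prodMap, Prod.map_apply, Prod.mk.injEq]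
  constructor
  · intro hab
    obtain ⟨u, v, huv, rfl, rfl⟩ := (h a b).1 (Or.inl hab)
    refine ⟨u, v, ?_, rfl, rfl⟩
    rcases huv with huv | huv
    · exact Or.inl ⟨huv, fun h' => G.asymm _ _ hab h'.2⟩
    · exact Or.inr ⟨huv, huv, hab⟩
  · rintro ⟨u, v, huv, rfl, rfl⟩
    rcases huv with ⟨huv, hR⟩ | ⟨-, -, hR⟩
    · rcases (h (f u) (f v)).2 ⟨u, v, Or.inl huv, rfl, rfl⟩ with h' | h'
      · exact h'
      · exact (hR ⟨huv, h'⟩).elim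
    · exact hR

theorem adj_reverse [DecidableEq W] {H : OrientedGraph W} {R : Finset (W × W)} (u v : W) :
    (H.reverse R).toSimpleGraph.Adj u v ↔ H.toSimpleGraph.Adj u v := by
  simp only [toSimpleGraph, mem_reverse]
  tauto

theorem isUnderlyingCopy_of_reverse [DecidableEq W] {H : OrientedGraph W} {G : OrientedGraph V}
    {f : W ↪ V} {R : Finset (W × W)} (h : G.edges = (H.reverse R).edges.map (f.prodMap f)) :
    IsUnderlyingCopy H G f := by
  intro a b
  have hadj : ∀ u v, H.toSimpleGraph.Adj u v ↔
      (u, v) ∈ (H.reverse R).edges ∨ (v, u) ∈ (H.reverse R).edges :=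
    fun u v => (adj_reverse u v).symm
  simp only [hadj]
  simp only [toSimpleGraph, h, Finset.mem_map, Prod.exists,
    Function.Embedding.coe_prodMap, Prod.map_apply, Prod.mk.injEq]
  constructor
  · rintro (⟨u, v, h, rfl, rfl⟩ | ⟨u, v, h, rfl, rfl⟩)
    · exact ⟨u, v, Or.inl h, rfl, rfl⟩
    · exact ⟨v, u, Or.inr h, rfl, rfl⟩
  · rintro ⟨u, v, h | h, rfl, rfl⟩
    · exact Or.inl ⟨u, v, h, rfl, rfl⟩
    · exact Or.inr ⟨v, u, h, rfl, rfl⟩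

theorem adj_path {m : ℕ} (a b : Fin (m + 1)) :
    (path m).toSimpleGraph.Adj a b ↔ (a : ℕ) + 1 = b ∨ (b : ℕ) + 1 = a := by
  have key : ∀ a b : Fin (m + 1), (a, b) ∈ (path m).edges ↔ (a : ℕ) + 1 = b := by
    intro a b
    simp only [path, Finset.mem_image, Finset.mem_univ, true_and, Prod.mk.injEq]
    constructor
    · rintro ⟨i, rfl, rfl⟩
      simp
    · intro h
      exact ⟨⟨a, by omega⟩, Fin.ext rfl, Fin.ext h⟩
  simp only [toSimpleGraph, key]

theorem adj_Q {n : ℕ} (a b : Fin (2 * n + 1)) :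
    (Q n).toSimpleGraph.Adj a b ↔ (a : ℕ) + 1 = b ∨ (b : ℕ) + 1 = a := by
  simp only [toSimpleGraph, Q, Finset.mem_filter, Finset.mem_univ, true_and]
  omega

theorem adj_D {k : ℕ} (a b : Fin (2 * k)) :
    (D k).toSimpleGraph.Adj a b ↔ (a : ℕ) + 1 = b ∨ (b : ℕ) + 1 = a ∨
      ((a : ℕ) = 0 ∧ (b : ℕ) + 1 = 2 * k) ∨ ((b : ℕ) = 0 ∧ (a : ℕ) + 1 = 2 * k) := by
  simp only [toSimpleGraph, D, Finset.mem_filter, Finset.mem_univ, true_and]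
  omega

theorem adj_disjointUnion {ι : Type*} [Fintype ι] {m : ι → ℕ}
    {H : ∀ i, OrientedGraph (Fin (m i + 1))}
    (hH : ∀ i a b, (H i).toSimpleGraph.Adj a b ↔ (a : ℕ) + 1 = b ∨ (b : ℕ) + 1 = a)
    (x y : Σ i, Fin (m i + 1)) :
    (disjointUnion H).toSimpleGraph.Adj x y ↔
      x.1 = y.1 ∧ ((x.2 : ℕ) + 1 = y.2 ∨ (y.2 : ℕ) + 1 = x.2) := by
  have key : ∀ x y : Σ i, Fin (m i + 1), (x, y) ∈ (disjointUnion H).edges ↔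
      ∃ i a b, (a, b) ∈ (H i).edges ∧ x = ⟨i, a⟩ ∧ y = ⟨i, b⟩ := by
    intro x y
    simp only [disjointUnion, Finset.mem_map, Finset.mem_sigma, Finset.mem_univ, true_and,
      Sigma.exists, Prod.exists]
    constructor
    · rintro ⟨i, a, b, h, heq⟩
      exact ⟨i, a, b, h, (Prod.mk.inj heq).1.symm, (Prod.mk.inj heq).2.symm⟩
    · rintro ⟨i, a, b, h, rfl, rfl⟩
      exact ⟨i, a, b, h, rfl⟩
  constructor
  · intro h
    rcases h with h | h
    · obtain ⟨i, a, b, hab, rfl, rfl⟩ := (key _ _).1 h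
      exact ⟨rfl, (hH i a b).1 (Or.inl hab)⟩
    · obtain ⟨i, a, b, hab, rfl, rfl⟩ := (key _ _).1 h
      exact ⟨rfl, (hH i b a).1 (Or.inr hab)⟩
  · obtain ⟨i, a⟩ := x
    obtain ⟨j, b⟩ := y
    rintro ⟨h, hab⟩
    obtain rfl : i = j := h
    rcases (hH i a b).2 hab with h | h
    · exact Or.inl ((key _ _).2 ⟨i, a, b, h, rfl, rfl⟩)
    · exact Or.inr ((key _ _).2 ⟨i, b, a, h, rfl, rfl⟩)

theorem sigma_fin_ext {ι : Type*} {m : ι → ℕ} {x y : Σ i, Fin (m i)} (h1 : x.1 = y.1)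
    (h2 : (x.2 : ℕ) = y.2) : x = y := by
  obtain ⟨i, a⟩ := x
  obtain ⟨j, b⟩ := y
  obtain rfl : i = j := h1
  exact congrArg _ (Fin.ext h2)

section Uniqueness

variable {ι ι' : Type*} [Fintype ι] [Fintype ι'] {m : ι → ℕ} {m' : ι' → ℕ}
  {H : ∀ i, OrientedGraph (Fin (m i + 1))} {H' : ∀ i, OrientedGraph (Fin (m' i + 1))}
  (hH : ∀ i a b, (H i).toSimpleGraph.Adj a b ↔ (a : ℕ) + 1 = b ∨ (b : ℕ) + 1 = a)
  (hH' : ∀ i a b, (H' i).toSimpleGraph.Adj a b ↔ (a : ℕ) + 1 = b ∨ (b : ℕ) + 1 = a)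
  {G : OrientedGraph V} {f : (Σ i, Fin (m i + 1)) ↪ V} {f' : (Σ i, Fin (m' i + 1)) ↪ V}
include hH hH'

/-- Two placements of disjoint unions of nontrivial paths with the same image match up the vertices,
and the components. -/
theorem exists_component_map (hm : ∀ i, 1 ≤ m i)
    (h : IsUnderlyingCopy (disjointUnion H) G f) (h' : IsUnderlyingCopy (disjointUnion H') G f') :
    ∃ φ : (Σ i, Fin (m i + 1)) → Σ i, Fin (m' i + 1),
      (∀ x, f' (φ x) = f x) ∧ ∀ x y, x.1 = y.1 → (φ x).1 = (φ y).1 := by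
  have hex : ∀ x, ∃ x', f' x' = f x := by
    rintro ⟨i, a⟩
    obtain ⟨b, hb⟩ : ∃ b : Fin (m i + 1), (a : ℕ) + 1 = b ∨ (b : ℕ) + 1 = a := by
      have := hm i
      rcases Nat.eq_zero_or_pos (a : ℕ) with h0 | h0
      · exact ⟨⟨1, by omega⟩, Or.inl (by simp only; omega)⟩
      · exact ⟨⟨a - 1, by omega⟩, Or.inr (by simp only; omega)⟩
    have hadj := (h (f ⟨i, a⟩) (f ⟨i, b⟩)).2
      ⟨_, _, (adj_disjointUnion hH ⟨i, a⟩ ⟨i, b⟩).2 ⟨rfl, hb⟩, rfl, rfl⟩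
    obtain ⟨u, v, -, hu, -⟩ := (h' _ _).1 hadj
    exact ⟨u, hu⟩
  choose φ hφ using hex
  have hstep : ∀ x y, (disjointUnion H).toSimpleGraph.Adj x y → (φ x).1 = (φ y).1 := by
    intro x y hxy
    obtain ⟨u, v, huv, hu, hv⟩ := (h' _ _).1 ((h (f x) (f y)).2 ⟨x, y, hxy, rfl, rfl⟩)
    have h1 : u = φ x := f'.injective (hu.trans (hφ x).symm)
    have h2 : v = φ y := f'.injective (hv.trans (hφ y).symm)
    rw [← h1, ← h2]
    exact ((adj_disjointUnion hH' u v).1 huv).1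
  have hzero : ∀ (i : ι) (a : ℕ) (ha : a < m i + 1), (φ ⟨i, ⟨a, ha⟩⟩).1 = (φ ⟨i, 0⟩).1 := by
    intro i a
    induction a with
    | zero => intro ha; rfl
    | succ a ih =>
      intro ha
      rw [← ih (by omega)]
      exact hstep _ _ ((adj_disjointUnion hH _ _).2 ⟨rfl, Or.inr rfl⟩)
  refine ⟨φ, hφ, ?_⟩
  rintro ⟨i, a⟩ ⟨j, b⟩ hij
  obtain rfl : i = j := hij
  rw [hzero i a a.2, hzero i b b.2]

/-- The lengths of the components of a disjoint union of nontrivial paths are determined by the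
graph. -/
theorem exists_equiv_lengths (hm : ∀ i, 1 ≤ m i) (hm' : ∀ i, 1 ≤ m' i)
    (h : IsUnderlyingCopy (disjointUnion H) G f) (h' : IsUnderlyingCopy (disjointUnion H') G f') :
    ∃ τ : ι ≃ ι', ∀ i, m' (τ i) = m i := by
  obtain ⟨φ, hφ, hc⟩ := exists_component_map hH hH' hm h h'
  obtain ⟨ψ, hψ, hd⟩ := exists_component_map hH' hH hm' h' h
  have hψφ : ∀ x, ψ (φ x) = x := fun x => f.injective ((hψ _).trans (hφ x))
  have hφψ : ∀ x, φ (ψ x) = x := fun x => f'.injective ((hφ _).trans (hψ x))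
  let τ : ι ≃ ι' :=
    { toFun := fun i => (φ ⟨i, 0⟩).1
      invFun := fun j => (ψ ⟨j, 0⟩).1
      left_inv := fun i => by
        have : (ψ ⟨(φ ⟨i, 0⟩).1, 0⟩).1 = (ψ (φ ⟨i, 0⟩)).1 := hd _ _ rfl
        simp only
        rw [this, hψφ]
      right_inv := fun j => by
        have : (φ ⟨(ψ ⟨j, 0⟩).1, 0⟩).1 = (φ (ψ ⟨j, 0⟩)).1 := hc _ _ rfl
        simp only
        rw [this, hφψ] }
  have h1 : ∀ i, m i ≤ m' (τ i) := by
    intro i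
    have hfst : ∀ a, (φ ⟨i, a⟩).1 = τ i := fun a => hc ⟨i, a⟩ ⟨i, 0⟩ rfl
    have := Fintype.card_le_of_injective
      (fun a : Fin (m i + 1) => (⟨(φ ⟨i, a⟩).2, hfst a ▸ (φ ⟨i, a⟩).2.2⟩ : Fin (m' (τ i) + 1)))
      (fun a b hab => by
        have h2 : φ ⟨i, a⟩ = φ ⟨i, b⟩ :=
          sigma_fin_ext ((hfst a).trans (hfst b).symm) (Fin.mk.inj hab)
        have h3 := (hψφ _).symm.trans ((congrArg ψ h2).trans (hψφ _))
        simpa using h3)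
    simpa using this
  have h2 : ∀ j, m' j ≤ m (τ.symm j) := by
    intro j
    have hfst : ∀ a, (ψ ⟨j, a⟩).1 = τ.symm j := fun a => hd ⟨j, a⟩ ⟨j, 0⟩ rfl
    have := Fintype.card_le_of_injective
      (fun a : Fin (m' j + 1) => (⟨(ψ ⟨j, a⟩).2, hfst a ▸ (ψ ⟨j, a⟩).2.2⟩ : Fin (m (τ.symm j) + 1)))
      (fun a b hab => by
        have h2 : ψ ⟨j, a⟩ = ψ ⟨j, b⟩ :=
          sigma_fin_ext ((hfst a).trans (hfst b).symm) (Fin.mk.inj hab)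
        have h3 := (hφψ _).symm.trans ((congrArg φ h2).trans (hφψ _))
        simpa using h3)
    simpa using this
  refine ⟨τ, fun i => le_antisymm ?_ (h1 i)⟩
  simpa using h2 (τ i)

end Uniqueness

theorem QUnion_unique {G : OrientedGraph V} {ns ns' : List ℕ} (h1 : ∀ n ∈ ns, 1 ≤ n)
    (h1' : ∀ n ∈ ns', 1 ≤ n) (hs : ns.Pairwise (· ≤ ·)) (hs' : ns'.Pairwise (· ≤ ·))
    {f : (Σ i : Fin ns.length, Fin (2 * ns.get i + 1)) ↪ V}
    {f' : (Σ i : Fin ns'.length, Fin (2 * ns'.get i + 1)) ↪ V}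
    (h : IsUnderlyingCopy (QUnion ns) G f) (h' : IsUnderlyingCopy (QUnion ns') G f') :
    ns = ns' := by
  obtain ⟨τ, hτ⟩ := exists_equiv_lengths (m := fun i => 2 * ns.get i)
    (m' := fun i => 2 * ns'.get i) (fun i => adj_Q) (fun i => adj_Q)
    (fun i => by have := h1 _ (List.get_mem ns i); omega)
    (fun i => by have := h1' _ (List.get_mem ns' i); omega) h h'
  have hlen : ns.length = ns'.length := by simpa using Fintype.card_congr τ
  refine List.Perm.eq_of_pairwise (le := (· ≤ ·)) (fun a b _ _ => le_antisymm) hs hs' ?_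
  rw [← Multiset.coe_eq_coe]
  have e : ∀ l : List ℕ, (l : Multiset ℕ) = (Finset.univ : Finset (Fin l.length)).val.map l.get :=
    fun l => by simp
  rw [e ns, e ns']
  have : ns.get = ns'.get ∘ τ := by
    funext i
    have := hτ i
    simp only [Function.comp]
    omega
  rw [this, ← Multiset.map_map]
  congr 1
  exact congrArg Finset.val (Finset.map_univ_equiv τ)

end OrientedGraph

/-! ### Runs of edges along a cycle -/

namespace OrientedGraph

variable {V : Type*}

/-- `[a, b]` is a maximal interval of length at least `1` all of whose steps `j → j + 1`
satisfy `p`. -/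
def IsMaxRun (p : ℕ → Prop) (a b : ℕ) : Prop :=
  a < b ∧ (∀ j, a ≤ j → j < b → p j) ∧ (∀ j, j + 1 = a → ¬ p j) ∧ ¬ p b

theorem IsMaxRun.eq_of_inter {p : ℕ → Prop} {a b a' b' x : ℕ} (h : IsMaxRun p a b)
    (h' : IsMaxRun p a' b') (hx : a ≤ x) (hx' : x ≤ b) (hy : a' ≤ x) (hy' : x ≤ b') :
    a = a' ∧ b = b' := by
  obtain ⟨h1, h2, h3, h4⟩ := h
  obtain ⟨k1, k2, k3, k4⟩ := h'
  have ha : a = a' := by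
    rcases lt_trichotomy a a' with hlt | heq | hgt
    · exact (k3 (a' - 1) (by omega) (h2 _ (by omega) (by omega))).elim
    · exact heq
    · exact (h3 (a - 1) (by omega) (k2 _ (by omega) (by omega))).elim
  refine ⟨ha, ?_⟩
  rcases lt_trichotomy b b' with hlt | heq | hgt
  · exact (h4 (k2 _ (by omega) (by omega))).elim
  · exact heq
  · exact (k4 (h2 _ (by omega) (by omega))).elim

theorem exists_isMaxRun {p : ℕ → Prop} {j ℓ : ℕ} (hp : p j) (hℓ : ∀ i, ℓ ≤ i + 1 → ¬ p i) :
    ∃ a b, IsMaxRun p a b ∧ a ≤ j ∧ j < b ∧ b < ℓ := by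
  classical
  have hA : ∃ a, a ≤ j ∧ ∀ i, a ≤ i → i ≤ j → p i := ⟨j, le_rfl, fun i h1 h2 => by
    rwa [le_antisymm h2 h1]⟩
  have hB : ∃ b, j ≤ b ∧ ¬ p b := ⟨max j ℓ, le_max_left _ _, hℓ _ (by omega)⟩
  have ha := Nat.find_spec hA
  have hb := Nat.find_spec hB
  have hamin := fun {m} => Nat.find_min hA (m := m)
  have hbmin := fun {m} => Nat.find_min hB (m := m)
  set a := Nat.find hA
  set b := Nat.find hB
  have hjb : j < b := lt_of_le_of_ne hb.1 fun h => hb.2 (h ▸ hp)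
  have hrun : ∀ i, a ≤ i → i < b → p i := by
    intro i h1 h2
    rcases le_or_gt i j with h3 | h3
    · exact ha.2 i h1 h3
    · by_contra h4
      exact hbmin h2 ⟨h3.le, h4⟩
  refine ⟨a, b, ⟨by omega, hrun, ?_, hb.2⟩, ha.1, hjb, ?_⟩
  · intro i hi hpi
    refine hamin (m := i) (by omega) ⟨by omega, fun k h1 h2 => ?_⟩
    rcases h1.eq_or_lt with h3 | h3
    · exact h3 ▸ hpi
    · exact ha.2 k (by omega) h2
  · by_contra h
    exact hℓ (b - 1) (by omega) (hrun _ (by omega) (by omega))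

/-- A graph all of whose edges join consecutive vertices of a linear order is, up to isolated
vertices, a disjoint union of nontrivial paths: one for each maximal run of edges. -/
theorem exists_disjointUnion_path {ℓ : ℕ} (G : OrientedGraph V) (e : Fin ℓ ≃ V)
    (hG : ∀ i j, G.toSimpleGraph.Adj (e i) (e j) → (i : ℕ) + 1 = j ∨ (j : ℕ) + 1 = i) :
    ∃ (ι : Type) (_ : Fintype ι) (m : ι → ℕ) (f : (Σ i, Fin (m i + 1)) ↪ V),
      (∀ i, 1 ≤ m i) ∧ IsUnderlyingCopy (disjointUnion fun i => path (m i)) G f := by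
  classical
  set p : ℕ → Prop := fun j => ∃ h : j + 1 < ℓ,
    G.toSimpleGraph.Adj (e ⟨j, by omega⟩) (e ⟨j + 1, h⟩) with hp
  have hpℓ : ∀ i, ℓ ≤ i + 1 → ¬ p i := fun i hi ⟨h, _⟩ => by omega
  -- The components are indexed by the maximal runs of edges.
  let ι := {q : Fin ℓ × Fin ℓ // IsMaxRun p q.1 q.2}
  let m : ι → ℕ := fun q => (q.1.2 : ℕ) - q.1.1
  have hlt : ∀ q : ι, (q.1.1 : ℕ) < q.1.2 := fun q => q.2.1
  let f : (Σ i, Fin (m i + 1)) → V := fun x =>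
    e ⟨x.1.1.1 + x.2, by
      have h1 := x.2.2
      have h2 := hlt x.1
      have h3 := x.1.1.2.2
      simp only [m] at h1
      omega⟩
  have hfinj : Function.Injective f := by
    rintro ⟨q, a⟩ ⟨q', a'⟩ hxy
    have h1 : (q.1.1 : ℕ) + a = q'.1.1 + a' := Fin.mk.inj (e.injective hxy)
    have ha := a.2
    have ha' := a'.2
    have hq := hlt q
    have hq' := hlt q'
    simp only [m] at ha ha'
    obtain ⟨h2, h3⟩ := q.2.eq_of_inter q'.2 (x := q.1.1 + a) (by omega) (by omega) (by omega)
      (by omega)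
    have h4 : q = q' := Subtype.ext (Prod.ext (Fin.ext h2) (Fin.ext h3))
    exact sigma_fin_ext h4 (by simp only; omega)
  refine ⟨ι, inferInstance, m, ⟨f, hfinj⟩, fun q => by have := hlt q; simp only [m]; omega, ?_⟩
  have hforward : ∀ i j : Fin ℓ, (i : ℕ) + 1 = j → G.toSimpleGraph.Adj (e i) (e j) →
      ∃ u v, (disjointUnion fun i => path (m i)).toSimpleGraph.Adj u v ∧ f u = e i ∧ f v = e j := by
    intro i j hij hadj
    have hpi : p i := ⟨by omega, by
      have : (⟨i + 1, by omega⟩ : Fin ℓ) = j := Fin.ext hij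
      rw [this]
      exact hadj⟩
    obtain ⟨a, b, hab, hai, hib, hbℓ⟩ := exists_isMaxRun hpi hpℓ
    let q : ι := ⟨(⟨a, by omega⟩, ⟨b, hbℓ⟩), hab⟩
    refine ⟨⟨q, ⟨i - a, ?_⟩⟩, ⟨q, ⟨i + 1 - a, ?_⟩⟩, ?_, ?_, ?_⟩
    · simp only [m, q]; omega
    · simp only [m, q]; omega
    · rw [adj_disjointUnion fun i => adj_path]
      exact ⟨rfl, Or.inl (by simp only; omega)⟩
    · exact congrArg e (Fin.ext (by simp only [q]; omega))
    · exact congrArg e (Fin.ext (by simp only [q]; omega))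
  intro a b
  constructor
  · intro hadj
    obtain ⟨i, rfl⟩ := e.surjective a
    obtain ⟨j, rfl⟩ := e.surjective b
    rcases hG i j hadj with h | h
    · exact hforward i j h hadj
    · obtain ⟨u, v, huv, hu, hv⟩ := hforward j i h hadj.symm
      exact ⟨v, u, huv.symm, hv, hu⟩
  · have hback : ∀ (q : ι) (a b : Fin (m q + 1)), (a : ℕ) + 1 = b →
        G.toSimpleGraph.Adj (f ⟨q, a⟩) (f ⟨q, b⟩) := by
      intro q a b hab
      have hb := b.2
      have hq := hlt q
      simp only [m] at hb
      obtain ⟨h1, h2⟩ := q.2.2.1 (q.1.1 + a) (by omega) (by omega)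
      convert! h2 using 3
      simp only
      omega
    rintro ⟨⟨q, a⟩, ⟨q', b⟩, huv, rfl, rfl⟩
    rw [adj_disjointUnion fun i => adj_path] at huv
    obtain ⟨hq, hab⟩ := huv
    obtain rfl : q = q' := hq
    rcases hab with h | h
    · exact hback q a b h
    · exact (hback q b a h).symm

/-- If all paths of a disjoint union have even length, it is one of the graphs `QUnion ns` up to
reversing edges. -/
theorem exists_QUnion {ι : Type*} [Fintype ι] {m : ι → ℕ} {G : OrientedGraph V}
    {f : (Σ i, Fin (m i + 1)) ↪ V} (hm : ∀ i, 1 ≤ m i) (heven : ∀ i, Even (m i))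
    (h : IsUnderlyingCopy (disjointUnion fun i => path (m i)) G f) :
    ∃ ns : List ℕ, (∀ n ∈ ns, 1 ≤ n) ∧ ns.Pairwise (· ≤ ·) ∧
      ∃ g, IsUnderlyingCopy (QUnion ns) G g := by
  classical
  choose n hn using fun i => (heven i).two_dvd
  let τ₀ : Fin (Fintype.card ι) ≃ ι := (Fintype.equivFin ι).symm
  let τ₁ : Fin (Fintype.card ι) ≃ ι := (Tuple.sort (n ∘ τ₀)).trans τ₀
  have hmono : Monotone (n ∘ τ₁) := Tuple.monotone_sort (n ∘ τ₀)
  let ns : List ℕ := List.ofFn (n ∘ τ₁)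
  have hlen : ns.length = Fintype.card ι := List.length_ofFn
  let τ : Fin ns.length ≃ ι := (finCongr hlen).trans τ₁
  have hget : ∀ i, ns.get i = n (τ i) := fun i => by
    simp [ns, τ]
    rfl
  have hlen' : ∀ i, 2 * ns.get i + 1 = m (τ i) + 1 := fun i => by rw [hget, hn]
  let g : (Σ i : Fin ns.length, Fin (2 * ns.get i + 1)) → Σ i, Fin (m i + 1) :=
    fun x => ⟨τ x.1, Fin.cast (hlen' x.1) x.2⟩
  have hginj : Function.Injective g := by
    rintro ⟨i, a⟩ ⟨j, b⟩ hxy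
    have h1 : i = j := τ.injective (congrArg Sigma.fst hxy)
    subst h1
    have h2 := eq_of_heq (Sigma.mk.inj hxy).2
    exact congrArg _ (Fin.cast_injective _ h2)
  have hgsurj : Function.Surjective g := by
    rintro ⟨i, a⟩
    obtain ⟨j, rfl⟩ := τ.surjective i
    exact ⟨⟨j, Fin.cast (hlen' j).symm a⟩, by simp [g]⟩
  refine ⟨ns, ?_, ?_, (⟨g, hginj⟩ : _ ↪ _).trans f, ?_⟩
  · intro k hk
    obtain ⟨i, rfl⟩ := List.get_of_mem hk
    have h1 := hm (τ i)
    have h2 := hn (τ i)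
    rw [hget]
    omega
  · exact List.pairwise_ofFn.2 fun i j hij => hmono hij.le
  · have hadj : ∀ x y, (QUnion ns).toSimpleGraph.Adj x y ↔
        (disjointUnion fun i => path (m i)).toSimpleGraph.Adj (g x) (g y) := by
      intro x y
      rw [QUnion, adj_disjointUnion (m := fun i => 2 * ns.get i) fun i => adj_Q,
        adj_disjointUnion fun i => adj_path]
      simp only [g, τ.injective.eq_iff, Fin.val_cast]
    intro a b
    rw [h a b]
    constructor
    · rintro ⟨u, v, huv, rfl, rfl⟩
      obtain ⟨x, rfl⟩ := hgsurj u
      obtain ⟨y, rfl⟩ := hgsurj v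
      exact ⟨x, y, (hadj x y).2 huv, rfl, rfl⟩
    · rintro ⟨x, y, hxy, rfl, rfl⟩
      exact ⟨g x, g y, (hadj x y).1 hxy, rfl, rfl⟩

/-- Adjacency in the cycle graph in terms of natural numbers. -/
theorem cyclic_sub_eq_one {n : ℕ} (i j : Fin (n + 2)) :
    i - j = 1 ↔ (j : ℕ) + 1 = i ∨ ((i : ℕ) = 0 ∧ (j : ℕ) + 1 = n + 2) := by
  have h := Fin.val_add_eq_ite j 1
  rw [sub_eq_iff_eq_add', Fin.ext_iff, h, Fin.val_one]
  split_ifs <;> omega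

/-- The vertices of a cycle, enumerated in cyclic order so that a given edge joins the last one to
the first one. -/
theorem IsCycleOrientation.exists_equiv {C : OrientedGraph V} {ℓ : ℕ}
    (hC : C.IsCycleOrientation ℓ) {a b : V} (hab : C.toSimpleGraph.Adj a b) :
    ∃ e : Fin ℓ ≃ V, (∀ i j, C.toSimpleGraph.Adj (e i) (e j) ↔
      (i : ℕ) + 1 = j ∨ (j : ℕ) + 1 = i ∨
      ((i : ℕ) = 0 ∧ (j : ℕ) + 1 = ℓ) ∨ ((j : ℕ) = 0 ∧ (i : ℕ) + 1 = ℓ)) ∧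
      ∀ i j : Fin _, (i : ℕ) = 0 → (j : ℕ) + 1 = ℓ → e i = a ∧ e j = b ∨ e i = b ∧ e j = a := by
  obtain ⟨h3, ⟨φ⟩⟩ := hC
  obtain ⟨n, rfl⟩ : ∃ n, ℓ = n + 2 := ⟨ℓ - 2, by omega⟩
  -- Adjacency in the cycle is invariant under rotations.
  have hrot : ∀ (r : Fin (n + 2)) (i j : Fin (n + 2)),
      C.toSimpleGraph.Adj (φ.symm (i + r)) (φ.symm (j + r)) ↔
        (i : ℕ) + 1 = j ∨ (j : ℕ) + 1 = i ∨
        ((i : ℕ) = 0 ∧ (j : ℕ) + 1 = n + 2) ∨ ((j : ℕ) = 0 ∧ (i : ℕ) + 1 = n + 2) := by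
    intro r i j
    rw [φ.symm.map_adj_iff, SimpleGraph.cycleGraph_adj, add_sub_add_right_eq_sub,
      add_sub_add_right_eq_sub, cyclic_sub_eq_one, cyclic_sub_eq_one]
    tauto
  have hlast : ∀ i j r : Fin (n + 2), (i : ℕ) = 0 → (j : ℕ) + 1 = n + 2 → r - (j + r) = 1 := by
    intro i j r hi hj
    have h1 : j = Fin.last (n + 1) := Fin.ext (by simp; omega)
    have h2 : j + 1 = 0 := by rw [h1, Fin.last_add_one]
    rw [sub_eq_iff_eq_add, ← add_assoc, add_comm 1 j, h2, zero_add]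
  have hadj := (φ.map_adj_iff).2 hab
  rw [SimpleGraph.cycleGraph_adj] at hadj
  have main : ∀ a b : V, φ a - φ b = 1 → ∃ e : Fin (n + 2) ≃ V,
      (∀ i j, C.toSimpleGraph.Adj (e i) (e j) ↔ (i : ℕ) + 1 = j ∨ (j : ℕ) + 1 = i ∨
        ((i : ℕ) = 0 ∧ (j : ℕ) + 1 = n + 2) ∨ ((j : ℕ) = 0 ∧ (i : ℕ) + 1 = n + 2)) ∧
      ∀ i j : Fin _, (i : ℕ) = 0 → (j : ℕ) + 1 = n + 2 → e i = a ∧ e j = b := by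
    intro a b h
    refine ⟨(Equiv.addRight (φ a)).trans φ.symm.toEquiv, hrot (φ a), fun i j hi hj => ?_⟩
    have hi0 : i = 0 := Fin.ext hi
    have h1 : j + φ a = φ b := by
      have := (hlast i j (φ a) hi hj).trans h.symm
      exact sub_right_injective this
    constructor
    · change φ.symm (i + φ a) = a
      rw [hi0, zero_add, RelIso.symm_apply_apply]
    · change φ.symm (j + φ a) = b
      rw [h1, RelIso.symm_apply_apply]
  rcases hadj with h | h
  · obtain ⟨e, he, he'⟩ := main a b h
    exact ⟨e, he, fun i j hi hj => Or.inl (he' i j hi hj)⟩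
  · obtain ⟨e, he, he'⟩ := main b a h
    exact ⟨e, he, fun i j hi hj => Or.inr (he' i j hi hj)⟩

end OrientedGraph

namespace OrientedGraph

/-! ### Bounds on the densities of `Q_{2n}` and `D_{2k}` -/

section Bounds

variable {U : I → I → ℝ} (hU : IsAntisymmKernel U)
include hU

theorem homDensity_Q_nonneg (n : ℕ) : 0 ≤ (Q n).homDensity U := by
  rw [homDensity_Q hU]
  exact integral_nonneg fun y => sq_nonneg _

theorem homDensity_Q_one_le : (Q 1).homDensity U ≤ 1 / 12 := by
  rw [homDensity_Q hU]
  exact hU.integral_sq_kerOp_one_le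

theorem homDensity_Q_succ_mul_le (n : ℕ) :
    (Q (n + 1)).homDensity U * Real.pi ^ (2 * n) ≤ (Q 1).homDensity U := by
  induction n with
  | zero => simp
  | succ n ih =>
    refine le_trans ?_ ih
    have h := hU.integral_sq_kerOp_le (hU.bddMeas_kerOp_iterate (BddMeas.const 1) (n + 1))
    rw [homDensity_Q hU, homDensity_Q hU]
    simp only [← Function.iterate_succ_apply' (kerOp U)] at h
    calc _ = (Real.pi ^ 2 * ∫ x, (kerOp U)^[n + 1 + 1] (fun _ => 1) x ^ 2) *
          Real.pi ^ (2 * n) := by ring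
      _ ≤ _ := by gcongr

/-- The weight of a term of the criterion bounds the density of the corresponding union of paths,
relative to the density of `Q_2`. -/
theorem prod_homDensity_Q_mul_le {ns : List ℕ} (h1 : ∀ n ∈ ns, 1 ≤ n) :
    (ns.map fun n => (Q n).homDensity U).prod *
        (12 ^ ns.length * Real.pi ^ (2 * ns.sum - 2 * ns.length)) ≤ 1 ∧
      (ns ≠ [] → (ns.map fun n => (Q n).homDensity U).prod *
        (12 ^ (ns.length - 1) * Real.pi ^ (2 * ns.sum - 2 * ns.length)) ≤
          (Q 1).homDensity U) := by
  induction ns with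
  | nil => simp
  | cons n l ih =>
    obtain ⟨ih, -⟩ := ih fun k hk => h1 k (List.mem_cons_of_mem _ hk)
    have hlen : l.length ≤ l.sum := by
      have := List.card_nsmul_le_sum l 1 fun k hk => h1 k (List.mem_cons_of_mem _ hk)
      simpa using this
    obtain ⟨m, rfl⟩ : ∃ m, n = m + 1 := ⟨n - 1, by have := h1 n List.mem_cons_self; omega⟩
    have hm := homDensity_Q_succ_mul_le hU m
    have hexp : 2 * (m + 1 + l.sum) - 2 * (l.length + 1) = 2 * m + (2 * l.sum - 2 * l.length) := by
      omega
    have hprod : 0 ≤ (l.map fun n => (Q n).homDensity U).prod :=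
      List.prod_nonneg fun x hx => by
        obtain ⟨k, -, rfl⟩ := List.mem_map.1 hx
        exact homDensity_Q_nonneg hU k
    have hle : (Q (m + 1)).homDensity U * Real.pi ^ (2 * m) *
        ((l.map fun n => (Q n).homDensity U).prod *
          (12 ^ l.length * Real.pi ^ (2 * l.sum - 2 * l.length))) ≤ (Q 1).homDensity U * 1 :=
      mul_le_mul hm ih (by positivity) (homDensity_Q_nonneg hU 1)
    rw [mul_one] at hle
    have h12 := homDensity_Q_one_le hU
    simp only [List.map_cons, List.prod_cons, List.length_cons, List.sum_cons, hexp,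
      Nat.add_sub_cancel, pow_add, pow_one]
    simp only [ne_eq, reduceCtorEq, not_false_eq_true, forall_const]
    constructor <;> linarith

theorem homDensity_D_nonneg {n : ℕ} (hn : 1 ≤ n) : 0 ≤ (D (n + 1)).homDensity U := by
  rw [homDensity_D hU hn]
  exact integral_nonneg fun y => integral_nonneg fun z => sq_nonneg _

theorem ae_eq_zero_of_homDensity_D {n : ℕ} (hn : 1 ≤ n) (h : (D (n + 1)).homDensity U = 0) :
    ∀ᵐ z : I × I, U z.1 z.2 = 0 := by
  obtain ⟨n, rfl⟩ : ∃ k, n = k + 1 := ⟨n - 1, by omega⟩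
  rw [homDensity_D hU hn] at h
  have hfam : BddMeas fun p : I × I => (kerOp U)^[n + 1] (fun w => U w p.1) p.2 ^ 2 :=
    (hU.bddMeas_kerOp_iterate_family (α := I) (h := fun y w => U w y)
      (hU.bddMeas_comp measurable_snd measurable_fst) (n + 1)).pow 2
  refine hU.ae_eq_zero_of_iterate_column (n := n) ?_
  have h1 := (integral_eq_zero_iff_of_nonneg
    (fun y => integral_nonneg fun z => sq_nonneg _) ((hfam.integral_right volume).integrable _)).1 h
  filter_upwards [h1] with y hy
  have h2 := (integral_eq_zero_iff_of_nonneg (fun z => sq_nonneg _)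
    ((hfam.comp (measurable_prodMk_left (x := y))).integrable _)).1 hy
  filter_upwards [h2] with z hz
  simpa using hz

end Bounds

/-! ### Spanning subgraphs of a cycle -/

theorem card_QUnion_edges (ns : List ℕ) : (QUnion ns).edges.card = 2 * ns.sum := by
  simp only [QUnion, disjointUnion, Finset.card_map, Finset.card_sigma, card_Q_edges]
  rw [← Finset.mul_sum]
  congr 1
  simp

theorem homDensity_QUnion (ns : List ℕ) (U : I → I → ℝ) :
    (QUnion ns).homDensity U = (ns.map fun n => (Q n).homDensity U).prod := by
  rw [QUnion, homDensity_disjointUnion]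
  rw [← List.prod_ofFn]
  congr 1
  exact List.ofFn_getElem_eq_map ns fun n => (Q n).homDensity U

variable {V : Type*}

theorem restrict_edges [DecidableEq V] {C : OrientedGraph V} {F : Finset (V × V)}
    (hF : F ⊆ C.edges) : (C.restrict F).edges = F :=
  Finset.inter_eq_right.2 hF

open scoped Classical in
/-- The contribution of the edge set `F` to `alpha C ns`. -/
noncomputable def copySign (C : OrientedGraph V) (ns : List ℕ) (F : Finset (V × V)) : ℤ :=
  (if ∃ R ⊆ (QUnion ns).edges,
    Even R.card ∧ ((QUnion ns).reverse R).IsCopyWithIsolated (C.restrict F) then 1 else 0) -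
  (if ∃ R ⊆ (QUnion ns).edges,
    Odd R.card ∧ ((QUnion ns).reverse R).IsCopyWithIsolated (C.restrict F) then 1 else 0)

theorem alpha_eq_sum (C : OrientedGraph V) (ns : List ℕ) :
    C.alpha ns = ∑ F ∈ C.edges.powerset, C.copySign ns F := by
  simp only [alpha, copySign, Finset.sum_sub_distrib, Finset.card_filter]
  push_cast
  rfl

open scoped Classical in
theorem exists_reverse_of_copySign_ne_zero {C : OrientedGraph V} {ns : List ℕ}
    {F : Finset (V × V)} (h : C.copySign ns F ≠ 0) :
    ∃ R ⊆ (QUnion ns).edges, ((QUnion ns).reverse R).IsCopyWithIsolated (C.restrict F) := by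
  by_contra hno
  push Not at hno
  apply h
  rw [copySign, if_neg, if_neg, sub_zero]
  · rintro ⟨R, hR, -, hc⟩
    exact hno R hR hc
  · rintro ⟨R, hR, -, hc⟩
    exact hno R hR hc

open scoped Classical in
theorem card_of_isCopy [Fintype V] {C : OrientedGraph V} {ns : List ℕ}
    {F : Finset (V × V)} (hF : F ⊆ C.edges) (h : ∃ R ⊆ (QUnion ns).edges,
      ((QUnion ns).reverse R).IsCopyWithIsolated (C.restrict F)) :
    F.card = 2 * ns.sum ∧ ns.length + 2 * ns.sum ≤ Fintype.card V := by
  obtain ⟨R, hR, f, hf⟩ := h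
  constructor
  · have h1 := congrArg Finset.card hf
    rw [Finset.card_map, card_reverse _ hR, card_QUnion_edges] at h1
    rw [← h1, restrict_edges hF]
  · have h1 := Fintype.card_le_of_embedding f
    simp only [Fintype.card_sigma, Fintype.card_fin, Finset.sum_add_distrib, Finset.sum_const,
      Finset.card_univ, smul_eq_mul, mul_one, ← Finset.mul_sum] at h1
    have h2 : ∑ i : Fin ns.length, ns.get i = ns.sum := by simp
    omega

theorem mem_patterns {ℓ : ℕ} {ns : List ℕ} : ns ∈ patterns ℓ ↔
    (∀ n ∈ ns, 1 ≤ n) ∧ ns.Pairwise (· ≤ ·) ∧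
      3 < ns.length + 2 * ns.sum ∧ ns.length + 2 * ns.sum ≤ ℓ := by
  simp [patterns, patternSet]

/-- `insert [1] (patterns ℓ)` consists of all nonempty non-decreasing lists of positive integers whose
union of paths has at most `ℓ` vertices; see `mem_insert_patterns` for the converse. -/
theorem of_mem_insert_patterns {ℓ : ℕ} {ns : List ℕ} (h : ns ∈ insert [1] (patterns ℓ)) :
    (∀ n ∈ ns, 1 ≤ n) ∧ ns.Pairwise (· ≤ ·) ∧ 1 ≤ ns.length ∧ 1 ≤ ns.sum := by
  rcases Finset.mem_insert.1 h with rfl | h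
  · simp
  · obtain ⟨h1, h2, h3, -⟩ := mem_patterns.1 h
    refine ⟨h1, h2, ?_⟩
    rcases ns with _ | ⟨n, l⟩
    · simp at h3
    · have := h1 n List.mem_cons_self
      simp
      omega

theorem mem_insert_patterns {ℓ : ℕ} {ns : List ℕ} (h1 : ∀ n ∈ ns, 1 ≤ n)
    (h2 : ns.Pairwise (· ≤ ·)) (h3 : ns ≠ []) (h4 : ns.length + 2 * ns.sum ≤ ℓ) :
    ns ∈ insert [1] (patterns ℓ) := by
  rw [Finset.mem_insert]
  by_cases h5 : 3 < ns.length + 2 * ns.sum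
  · exact Or.inr (mem_patterns.2 ⟨h1, h2, h5, h4⟩)
  · left
    rcases ns with _ | ⟨n, _ | ⟨m, l⟩⟩
    · exact (h3 rfl).elim
    · have := h1 n List.mem_cons_self
      simp only [List.length_cons, List.length_nil, List.sum_cons, List.sum_nil] at h5
      obtain rfl : n = 1 := by omega
      rfl
    · have := h1 n List.mem_cons_self
      have := h1 m (List.mem_cons_of_mem _ List.mem_cons_self)
      simp only [List.length_cons, List.sum_cons] at h5
      omega

section Density

variable [Fintype V] {U : I → I → ℝ} (hU : IsAntisymmKernel U)
include hU

open scoped Classical in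
theorem homDensity_restrict_of_reverse {C : OrientedGraph V} {ns : List ℕ} {F : Finset (V × V)}
    {R : Finset (_ × _)} (hR : R ⊆ (QUnion ns).edges)
    (h : ((QUnion ns).reverse R).IsCopyWithIsolated (C.restrict F)) :
    (C.restrict F).homDensity U =
      (-1) ^ R.card * (ns.map fun n => (Q n).homDensity U).prod := by
  rw [homDensity_eq_of_isCopy hU h, homDensity_reverse hU _ hR, homDensity_QUnion]

open scoped Classical in
/-- If a graph is a copy both with an even and with an odd number of reversed edges, its density
vanishes, in accordance with the two contributions to `alpha` cancelling each other. -/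
theorem homDensity_restrict_eq_copySign_mul {C : OrientedGraph V} {ns : List ℕ}
    {F : Finset (V × V)} (h : ∃ R ⊆ (QUnion ns).edges,
      ((QUnion ns).reverse R).IsCopyWithIsolated (C.restrict F)) :
    (C.restrict F).homDensity U =
      C.copySign ns F * (ns.map fun n => (Q n).homDensity U).prod := by
  have heven : (∃ R ⊆ (QUnion ns).edges,
      Even R.card ∧ ((QUnion ns).reverse R).IsCopyWithIsolated (C.restrict F)) →
      (C.restrict F).homDensity U = (ns.map fun n => (Q n).homDensity U).prod := by
    rintro ⟨R, hR, hp, hc⟩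
    rw [homDensity_restrict_of_reverse hU hR hc, hp.neg_one_pow, one_mul]
  have hodd : (∃ R ⊆ (QUnion ns).edges,
      Odd R.card ∧ ((QUnion ns).reverse R).IsCopyWithIsolated (C.restrict F)) →
      (C.restrict F).homDensity U = -(ns.map fun n => (Q n).homDensity U).prod := by
    rintro ⟨R, hR, hp, hc⟩
    rw [homDensity_restrict_of_reverse hU hR hc, hp.neg_one_pow, neg_one_mul]
  rw [copySign]
  split_ifs with h1 h2 h2
  · rw [heven h1]
    have h3 := heven h1
    have h4 := hodd h2
    push_cast
    linarith
  · rw [heven h1]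
    simp
  · rw [hodd h2]
    simp
  · obtain ⟨R, hR, hc⟩ := h
    rcases Nat.even_or_odd R.card with hp | hp
    · exact (h1 ⟨R, hR, hp, hc⟩).elim
    · exact (h2 ⟨R, hR, hp, hc⟩).elim

open scoped Classical in
/-- A proper spanning subgraph of a cycle with nonzero density is a disjoint union of paths of even
length. -/
theorem exists_reverse_of_homDensity_ne_zero {C : OrientedGraph V} {ℓ : ℕ}
    (hC : C.IsCycleOrientation ℓ) {F : Finset (V × V)} (hF : F ⊆ C.edges) (hne : F ≠ C.edges)
    (h : (C.restrict F).homDensity U ≠ 0) :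
    ∃ ns : List ℕ, (∀ n ∈ ns, 1 ≤ n) ∧ ns.Pairwise (· ≤ ·) ∧ ∃ R ⊆ (QUnion ns).edges,
      ((QUnion ns).reverse R).IsCopyWithIsolated (C.restrict F) := by
  obtain ⟨⟨a, b⟩, hab, habF⟩ := Finset.exists_of_ssubset (lt_of_le_of_ne hF hne)
  obtain ⟨e, he, hends⟩ := hC.exists_equiv (Or.inl hab)
  have hedge : ∀ u v, (u, v) ∈ (C.restrict F).edges ↔ (u, v) ∈ F := fun u v => by
    rw [restrict_edges hF]
  have hle : ∀ u v, (C.restrict F).toSimpleGraph.Adj u v → C.toSimpleGraph.Adj u v := by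
    intro u v huv
    simp only [toSimpleGraph, hedge] at huv
    exact huv.imp (fun h => hF h) fun h => hF h
  have hmiss : ¬ (C.restrict F).toSimpleGraph.Adj a b := by
    intro hadj
    simp only [toSimpleGraph, hedge] at hadj
    exact hadj.elim habF fun h => C.asymm _ _ hab (hF h)
  have hclose : ∀ i j : Fin ℓ, (i : ℕ) = 0 → (j : ℕ) + 1 = ℓ →
      ¬ (C.restrict F).toSimpleGraph.Adj (e i) (e j) := by
    intro i j hi hj hadj
    rcases hends i j hi hj with ⟨h1, h2⟩ | ⟨h1, h2⟩
    · exact hmiss (h1 ▸ h2 ▸ hadj)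
    · exact hmiss (h1 ▸ h2 ▸ hadj.symm)
  obtain ⟨ι, _, m, f, hm, hf⟩ := exists_disjointUnion_path (C.restrict F) e fun i j hadj => by
    rcases (he i j).1 (hle _ _ hadj) with h | h | ⟨h1, h2⟩ | ⟨h1, h2⟩
    · exact Or.inl h
    · exact Or.inr h
    · exact (hclose i j h1 h2 hadj).elim
    · exact (hclose j i h1 h2 hadj.symm).elim
  have heven : ∀ i, Even (m i) := by
    intro i
    by_contra hodd
    apply h
    obtain ⟨R, hR, hcopy⟩ := hf.exists_reverse
    rw [homDensity_eq_of_isCopy hU ⟨f, hcopy⟩, homDensity_reverse hU _ hR,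
      homDensity_disjointUnion, Finset.prod_eq_zero (Finset.mem_univ i)
        (homDensity_path_odd hU (Nat.not_even_iff_odd.1 hodd)), mul_zero]
  obtain ⟨ns, h1, h2, g, hg⟩ := exists_QUnion hm heven hf
  obtain ⟨R, hR, hcopy⟩ := hg.exists_reverse
  exact ⟨ns, h1, h2, R, hR, g, hcopy⟩

open scoped Classical in
/-- The weighted density of each spanning subgraph is accounted for exactly once: by the constant
term, by the cycle itself, or by the unique list `ns` of path lengths that it realises. -/
theorem homDensity_restrict_eq_sum {C : OrientedGraph V} {ℓ : ℕ} (hC : C.IsCycleOrientation ℓ)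
    (hV : Fintype.card V = ℓ) (hE : C.edges.card = ℓ) {F : Finset (V × V)} (hF : F ⊆ C.edges) :
    (1 / 2) ^ (ℓ - F.card) * (C.restrict F).homDensity U =
      (if F = ∅ then (1 / 2) ^ ℓ else 0) + (if F = C.edges then C.homDensity U else 0) +
      ∑ ns ∈ insert [1] (patterns ℓ), (C.copySign ns F : ℝ) *
        ((ns.map fun n => (Q n).homDensity U).prod / 2 ^ (ℓ - 2 * ns.sum)) := by
  have hℓ := hC.1
  have hsum : F = ∅ ∨ F = C.edges → ∑ ns ∈ insert [1] (patterns ℓ), (C.copySign ns F : ℝ) *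
      ((ns.map fun n => (Q n).homDensity U).prod / 2 ^ (ℓ - 2 * ns.sum)) = 0 := by
    intro hF'
    refine Finset.sum_eq_zero fun ns hns => ?_
    obtain ⟨-, -, h1, h2⟩ := of_mem_insert_patterns hns
    by_cases hs : C.copySign ns F = 0
    · rw [hs, Int.cast_zero, zero_mul]
    · obtain ⟨h3, h4⟩ := card_of_isCopy hF (exists_reverse_of_copySign_ne_zero hs)
      rcases hF' with rfl | rfl
      · rw [Finset.card_empty] at h3
        omega
      · omega
  by_cases hF0 : F = ∅
  · have hne : F ≠ C.edges := by
      rintro rfl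
      rw [hF0, Finset.card_empty] at hE
      omega
    rw [hsum (Or.inl hF0), if_pos hF0, if_neg hne, homDensity, restrict_edges hF, hF0]
    simp
  by_cases hFE : F = C.edges
  · have : C.restrict F = C := OrientedGraph.ext (by rw [restrict_edges hF, hFE])
    rw [hsum (Or.inr hFE), if_neg hF0, if_pos hFE, this, hFE, hE]
    simp
  rw [if_neg hF0, if_neg hFE, zero_add, zero_add]
  by_cases hex : ∃ ns : List ℕ, (∀ n ∈ ns, 1 ≤ n) ∧ ns.Pairwise (· ≤ ·) ∧
      ∃ R ⊆ (QUnion ns).edges, ((QUnion ns).reverse R).IsCopyWithIsolated (C.restrict F)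
  · obtain ⟨ns, h1, h2, hcopy⟩ := hex
    obtain ⟨h3, h4⟩ := card_of_isCopy hF hcopy
    rw [hV] at h4
    have hns : ns ≠ [] := by
      rintro rfl
      exact hF0 (Finset.card_eq_zero.1 (by simpa using h3))
    rw [Finset.sum_eq_single_of_mem ns (mem_insert_patterns h1 h2 hns h4)]
    · rw [homDensity_restrict_eq_copySign_mul hU hcopy, h3, one_div, inv_pow]
      ring
    · intro ns' hns' hne
      obtain ⟨h1', h2', -, -⟩ := of_mem_insert_patterns hns'
      have : C.copySign ns' F = 0 := by
        by_contra hs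
        obtain ⟨R, -, f, hf⟩ := hcopy
        obtain ⟨R', -, f', hf'⟩ := exists_reverse_of_copySign_ne_zero hs
        exact hne (QUnion_unique h1' h1 h2' h2 (isUnderlyingCopy_of_reverse hf')
          (isUnderlyingCopy_of_reverse hf))
      rw [this, Int.cast_zero, zero_mul]
  · have h0 : (C.restrict F).homDensity U = 0 := by
      by_contra h0
      exact hex (exists_reverse_of_homDensity_ne_zero hU hC hF hFE h0)
    rw [h0, mul_zero, Finset.sum_eq_zero fun ns hns => ?_]
    obtain ⟨h1, h2, -, -⟩ := of_mem_insert_patterns hns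
    have : C.copySign ns F = 0 := by
      by_contra hs
      exact hex ⟨ns, h1, h2, exists_reverse_of_copySign_ne_zero hs⟩
    rw [this, Int.cast_zero, zero_mul]

open scoped Classical in
/-- Expanding the density of `1/2 + U` over all spanning subgraphs. -/
theorem homDensity_half_add (C : OrientedGraph V) :
    C.homDensity (fun x y => U x y + 1 / 2) = ∑ F ∈ C.edges.powerset,
      (1 / 2) ^ (C.edges.card - F.card) * (C.restrict F).homDensity U := by
  have h : ∀ x : V → I, ∏ e ∈ C.edges, (U (x e.1) (x e.2) + 1 / 2) =
      ∑ F ∈ C.edges.powerset, (1 / 2) ^ (C.edges.card - F.card) * ∏ e ∈ F, U (x e.1) (x e.2) := by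
    intro x
    rw [Finset.prod_add]
    refine Finset.sum_congr rfl fun F hF => ?_
    rw [Finset.prod_const, Finset.card_sdiff_of_subset (Finset.mem_powerset.1 hF), mul_comm]
  simp only [homDensity, h]
  rw [integral_finsetSum _ fun F _ =>
    ((bddMeas_prod_edges hU F).integrable volume).const_mul _]
  refine Finset.sum_congr rfl fun F hF => ?_
  rw [integral_const_mul, restrict_edges (Finset.mem_powerset.1 hF)]

/-- The expansion of the density of a cycle in `1/2 + U`. -/
theorem homDensity_cycle_expansion {C : OrientedGraph V} {ℓ : ℕ} (hC : C.IsCycleOrientation ℓ)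
    (hV : Fintype.card V = ℓ) (hE : C.edges.card = ℓ) :
    C.homDensity (fun x y => U x y + 1 / 2) = (1 / 2) ^ ℓ + C.homDensity U +
      ∑ ns ∈ insert [1] (patterns ℓ), (C.alpha ns : ℝ) *
        ((ns.map fun n => (Q n).homDensity U).prod / 2 ^ (ℓ - 2 * ns.sum)) := by
  classical
  rw [homDensity_half_add hU, hE]
  rw [Finset.sum_congr rfl fun F hF =>
    homDensity_restrict_eq_sum hU hC hV hE (Finset.mem_powerset.1 hF)]
  rw [Finset.sum_add_distrib, Finset.sum_add_distrib, Finset.sum_comm,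
    Finset.sum_ite_eq', Finset.sum_ite_eq', if_pos (Finset.empty_mem_powerset _),
    if_pos (Finset.mem_powerset_self _)]
  congr 1
  refine Finset.sum_congr rfl fun ns _ => ?_
  rw [alpha_eq_sum, Int.cast_sum, Finset.sum_mul]

end Density

/-- An orientation of an even cycle arises from `D_{2k}` by reversing edges. -/
theorem IsCycleOrientation.exists_reverse_D {C : OrientedGraph V} {k : ℕ}
    (hC : C.IsCycleOrientation (2 * k)) : ∃ R ⊆ (D k).edges, ∃ f : Fin (2 * k) ≃ V,
      C.edges = ((D k).reverse R).edges.map (f.toEmbedding.prodMap f.toEmbedding) := by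
  obtain ⟨h3, ⟨φ⟩⟩ := id hC
  have hadj : C.toSimpleGraph.Adj (φ.symm ⟨0, by omega⟩) (φ.symm ⟨1, by omega⟩) := by
    rw [φ.symm.map_adj_iff]
    rw [SimpleGraph.cycleGraph_adj']
    right
    rw [Fin.sub_val_of_le (Fin.mk_le_mk.2 zero_le_one)]
    rfl
  obtain ⟨e, he, -⟩ := hC.exists_equiv hadj
  have hcopy : IsUnderlyingCopy (D k) C e.toEmbedding := by
    intro a b
    obtain ⟨i, rfl⟩ := e.surjective a
    obtain ⟨j, rfl⟩ := e.surjective b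
    rw [he, ← adj_D]
    constructor
    · exact fun h => ⟨i, j, h, rfl, rfl⟩
    · rintro ⟨u, v, huv, hu, hv⟩
      rwa [e.injective hu, e.injective hv] at huv
  obtain ⟨R, hR, h⟩ := hcopy.exists_reverse
  exact ⟨R, hR, e, h⟩

/-- A term of the expansion is at most `t(Q_2, U)` times the corresponding term of the
criterion. -/
theorem criterion_le {U : I → I → ℝ} (hU : IsAntisymmKernel U) {ℓ : ℕ} {ns : List ℕ}
    (hns : ns ∈ patterns ℓ) {c : ℝ} (hc : 0 ≤ c) :
    c * ((ns.map fun n => (Q n).homDensity U).prod / 2 ^ (ℓ - 2 * ns.sum)) ≤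
      (Q 1).homDensity U * (c / (12 ^ (ns.length - 1) *
        Real.pi ^ (2 * ns.sum - 2 * ns.length) * 2 ^ (ℓ - 2 * ns.sum))) := by
  obtain ⟨h1, -, h3, -⟩ := of_mem_insert_patterns (Finset.mem_insert_of_mem hns)
  have h := (prod_homDensity_Q_mul_le hU h1).2 (List.length_pos_iff.1 h3)
  have hpos : (0 : ℝ) < 12 ^ (ns.length - 1) * Real.pi ^ (2 * ns.sum - 2 * ns.length) := by
    have := Real.pi_pos
    positivity
  have h' := (le_div_iff₀ hpos).2 h
  calc _ ≤ c * ((Q 1).homDensity U / (12 ^ (ns.length - 1) *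
        Real.pi ^ (2 * ns.sum - 2 * ns.length)) / 2 ^ (ℓ - 2 * ns.sum)) := by gcongr
    _ = _ := by
      rw [div_div]
      ring

end OrientedGraph

/-! ### Quasirandom-forcing cycles -/

namespace OrientedGraph

variable {V : Type*} [Fintype V]

theorem homDensity_eq_gamma_mul {U : I → I → ℝ} (hU : IsAntisymmKernel U) {C : OrientedGraph V}
    {k : ℕ} (hC : C.IsCycleOrientation (2 * k)) (hE : C.edges.card = 2 * k) :
    C.homDensity U = C.gamma * (D k).homDensity U := by
  have hdiv : C.edges.card / 2 = k := by omega
  rw [gamma, hdiv]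
  split_ifs with h
  · obtain ⟨R, hR, hp, f, hf⟩ := h
    rw [homDensity_eq_of_isCopy hU ⟨f.toEmbedding, hf⟩, homDensity_reverse hU _ hR,
      hp.neg_one_pow]
    simp
  · obtain ⟨R, hR, f, hf⟩ := hC.exists_reverse_D
    have hodd : Odd R.card := by
      rw [← Nat.not_even_iff_odd]
      intro hp
      refine h ⟨R, hR, hp, f, ?_⟩
      convert! hf
    rw [homDensity_eq_of_isCopy hU ⟨f.toEmbedding, hf⟩, homDensity_reverse hU _ hR,
      hodd.neg_one_pow]
    simp

/-- The cases `γ = 1` and `γ = -1` in a uniform form: it suffices that the path terms of the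
expansion, multiplied by `γ`, are non-negative for each kernel. -/
theorem quasirandomForcing_of_nonneg {C : OrientedGraph V} {ℓ : ℕ} (hℓ : Even ℓ)
    (hC : C.IsCycleOrientation ℓ)
    (h : ∀ U : I → I → ℝ, IsAntisymmKernel U → 0 ≤ (C.gamma : ℝ) *
      ∑ ns ∈ insert [1] (patterns ℓ), (C.alpha ns : ℝ) *
        ((ns.map fun n => (Q n).homDensity U).prod / 2 ^ (ℓ - 2 * ns.sum))) :
    C.QuasirandomForcing := by
  intro W hW hdens
  obtain ⟨k, rfl⟩ := hℓ.two_dvd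
  obtain ⟨n, rfl⟩ : ∃ n, k = n + 1 := ⟨k - 1, by have := hC.1; omega⟩
  have hn : 1 ≤ n := by have := hC.1; omega
  have hE : C.edges.card = 2 * (n + 1) := by
    obtain ⟨R, hR, f, hf⟩ := hC.exists_reverse_D
    rw [hf, Finset.card_map, card_reverse _ hR, card_D_edges hn]
  have hV : Fintype.card V = 2 * (n + 1) := by
    obtain ⟨-, ⟨φ⟩⟩ := id hC
    simpa using Fintype.card_congr φ.toEquiv
  set U : I → I → ℝ := fun x y => W x y - 1 / 2 with hUdef
  have hU : IsAntisymmKernel U := by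
    refine ⟨hW.measurable.sub_const _, fun x y => ?_, fun x y => ?_⟩
    · have := hW.add_swap x y
      simp only [hUdef]
      linarith
    · have h1 := hW.add_swap x y
      have h2 := hW.nonneg x y
      have h3 := hW.nonneg y x
      exact abs_le.2 ⟨by simp only [hUdef]; linarith, by simp only [hUdef]; linarith⟩
  have hWU : W = fun x y => U x y + 1 / 2 := by
    funext x y
    simp [hUdef]
  have hexp := homDensity_cycle_expansion hU hC hV hE
  rw [← hWU, hdens, hE, homDensity_eq_gamma_mul hU hC hE] at hexp
  have hγ : (C.gamma : ℝ) * C.gamma = 1 := by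
    rw [gamma]
    split_ifs <;> simp
  have h0 := h U hU
  have hD := homDensity_D_nonneg hU hn
  have hzero : (D (n + 1)).homDensity U = 0 := by
    refine le_antisymm ?_ hD
    set S := ∑ ns ∈ insert [1] (patterns (2 * (n + 1))), (C.alpha ns : ℝ) *
        ((ns.map fun n => (Q n).homDensity U).prod / 2 ^ (2 * (n + 1) - 2 * ns.sum))
    have h1 : (C.gamma : ℝ) * (D (n + 1)).homDensity U + S = 0 := by linarith
    have h2 : (C.gamma : ℝ) * ((C.gamma : ℝ) * (D (n + 1)).homDensity U + S) = 0 := by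
      rw [h1, mul_zero]
    rw [mul_add, ← mul_assoc, hγ, one_mul] at h2
    linarith
  filter_upwards [ae_eq_zero_of_homDensity_D hU hn hzero] with z hz
  simp only [hUdef] at hz
  linarith

theorem one_notMem_patterns (ℓ : ℕ) : [1] ∉ patterns ℓ := fun h => by
  have := (mem_patterns.1 h).2.2.1
  simp at this

end OrientedGraph

theorem mainTheorem3 {V : Type*} [Fintype V] (C : OrientedGraph V) (ℓ : ℕ) (hℓ : Even ℓ)
    (hC : C.IsCycleOrientation ℓ) :
    (C.gamma = 1 →
      0 ≤ (C.alpha [1] : ℝ) / 2 ^ (ℓ - 2) +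
        ∑ ns ∈ patterns ℓ, min 0 (C.alpha ns : ℝ) /
          (12 ^ (ns.length - 1) * Real.pi ^ (2 * ns.sum - 2 * ns.length) * 2 ^ (ℓ - 2 * ns.sum)) →
      C.QuasirandomForcing) ∧
    (C.gamma = -1 →
      (C.alpha [1] : ℝ) / 2 ^ (ℓ - 2) +
        ∑ ns ∈ patterns ℓ, max 0 (C.alpha ns : ℝ) /
          (12 ^ (ns.length - 1) * Real.pi ^ (2 * ns.sum - 2 * ns.length) * 2 ^ (ℓ - 2 * ns.sum)) ≤ 0 →
      C.QuasirandomForcing) := by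
  have hP : ∀ U : I → I → ℝ, IsAntisymmKernel U → ∀ ns : List ℕ,
      0 ≤ (ns.map fun n => (OrientedGraph.Q n).homDensity U).prod / 2 ^ (ℓ - 2 * ns.sum) := fun U hU ns =>
    div_nonneg (List.prod_nonneg fun x hx => by
      obtain ⟨k, -, rfl⟩ := List.mem_map.1 hx
      exact OrientedGraph.homDensity_Q_nonneg hU k) (by positivity)
  constructor
  · intro hγ hcrit
    refine OrientedGraph.quasirandomForcing_of_nonneg hℓ hC fun U hU => ?_
    rw [hγ, Int.cast_one, one_mul, Finset.sum_insert (OrientedGraph.one_notMem_patterns ℓ)]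
    refine (mul_nonneg (OrientedGraph.homDensity_Q_nonneg hU 1) hcrit).trans ?_
    rw [mul_add, Finset.mul_sum]
    refine add_le_add (le_of_eq (by simp; ring)) (Finset.sum_le_sum fun ns hns => ?_)
    have h1 := OrientedGraph.criterion_le hU hns (c := -min 0 (C.alpha ns : ℝ)) (by simp)
    have h2 := mul_le_mul_of_nonneg_right (min_le_right 0 (C.alpha ns : ℝ)) (hP U hU ns)
    rw [neg_div] at h1
    linarith
  · intro hγ hcrit
    refine OrientedGraph.quasirandomForcing_of_nonneg hℓ hC fun U hU => ?_
    rw [hγ, Int.cast_neg, Int.cast_one, neg_one_mul, neg_nonneg,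
      Finset.sum_insert (OrientedGraph.one_notMem_patterns ℓ)]
    refine le_trans ?_ (mul_nonpos_of_nonneg_of_nonpos (OrientedGraph.homDensity_Q_nonneg hU 1) hcrit)
    rw [mul_add, Finset.mul_sum]
    refine add_le_add (le_of_eq (by simp; ring)) (Finset.sum_le_sum fun ns hns => ?_)
    have h1 := OrientedGraph.criterion_le hU hns (c := max 0 (C.alpha ns : ℝ)) (by simp)
    have h2 := mul_le_mul_of_nonneg_right (le_max_right 0 (C.alpha ns : ℝ)) (hP U hU ns)
    linarith
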